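/- Let $\mathbf y_1\neq\mathbf y_2$ be points of $\mathbb R^3$, $s_1,s_2>0$, and write $r_i=|\mathbf x-\mathbf y_i|$, $\mathbf n_i=(\mathbf x-\mathbf y_i)/r_i$, $r_{12}=|\mathbf y_1-\mathbf y_2|$. Let $\mathcal F$ be the class of functions $F:\mathbb R^3\to\mathbb R$ that are $C^\infty$ on $\mathbb R^3\setminus\{\mathbf y_1,\mathbf y_2\}$ and for which there are real exponents $a_0<a_1<\cdots$, finitely many below any bound, and functions ${}_1f_{a_i}$ on the unit sphere with, for every $N\in\mathbb N$, $$F(\mathbf x)=\sum_{a_i\le N} r_1^{a_i}\,{}_1f_{a_i}(\mathbf n_1)+o(r_1^N)\qquad (r_1\to0),$$ and similarly exponents $b_i$ and functions ${}_2f_{b_i}$ at $\mathbf y_2$. Let $F\in\mathcal F$ be summable at infinity in the sense that $|\mathbf x|^{\epsilon}F(\mathbf x)$ is integrable in a neighbourhood of infinity for some $\epsilon>0$ (this holds in particular if $F=O(|\mathbf x|^{-3-\epsilon'})$ with $\epsilon'>0$). Let $\mathcal B_i(s)=\{r_i\le s\}$. (a) The Hadamard partie finie $$\mathrm{Pf}_{s_1,s_2}\!\int\!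 d^3\mathbf x\,F=\lim_{s\to0^+}\Big\{\int_{\mathbb R^3\setminus(\mathcal B_1(s)\cup\mathcal B_2(s))}\!\!F\,d^3\mathbf x+\sum_{a+3<0}\frac{s^{a+3}}{a+3}\int {}_1f_a\,d\Omega_1+\ln\frac{s}{s_1}\int {}_1f_{-3}\,d\Omega_1+\sum_{b+3<0}\frac{s^{b+3}}{b+3}\int {}_2f_b\,d\Omega_2+\ln\frac{s}{s_2}\int {}_2f_{-3}\,d\Omega_2\Big\}$$ exists (the logarithmic terms being present only if $-3$ is among the exponents concerned). (b) For $\alpha,\beta\in\mathbb C$ let $I_{\alpha,\beta}=\int d^3\mathbf x\,(r_1/s_1)^\alpha(r_2/s_2)^\beta F$, understood by analytic continuation as follows. For $0<s<r_{12}/2$, the part of the integral over $\mathcal B_1(s)$ converges absolutely for $\Re\alpha$ large and every $\beta$, and continues analytically to $(\mathbb C\setminus D_1)\times\mathbb C\ni(\alpha,\beta)$ with $D_1$ closed and discrete; the part over $\mathcal B_2(s)$ converges absolutely for $\Re\beta$ large and every $\alpha$, and continues analytically to $\mathbb C\times(\mathbb C\setminus D_2)\ni(\alpha,\beta)$ with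 $D_2$ closed and discrete; the part over $\mathbb R^3\setminus(\mathcal B_1(s)\cup\mathcal B_2(s))$ converges absolutely for $(\alpha,\beta)$ near $(0,0)$; and $I_{\alpha,\beta}$ is the sum of these three functions on a set $\{0<|\alpha|<\delta,\ 0<|\beta|<\delta\}$, $\delta>0$. Such a continuation exists. (c) Let $\mathrm{FP}_{z\to0}$ denote the zeroth-order coefficient of the Laurent expansion at $z=0$ (with finite principal part). For any choice of $s$ in (b), for all small fixed $\beta\ne0$ the function $\alpha\mapsto I_{\alpha,\beta}$ has such a Laurent expansion at $0$, and so does the resulting function $\beta\mapsto\mathrm{FP}_{\alpha\to0}I_{\alpha,\beta}$; the same holds with the roles of $\alpha$ and $\beta$ exchanged; and $$\mathrm{Pf}_{s_1,s_2}\!\int\! d^3\mathbf x\,F=\mathrm{FP}_{\beta\to0}\Big\{\mathrm{FP}_{\alpha\to0}I_{\alpha,\beta}\Big\}=\mathrm{FP}_{\alpha\to0}\Big\{\mathrm{FP}_{\beta\to0}I_{\alpha,\beta}\Big\}.$$ -/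

import Mathlib

open MeasureTheory Filter Topology

noncomputable section

namespace HadamardPf

/-- Three-dimensional Euclidean space. -/
abbrev Space : Type := EuclideanSpace ℝ (Fin 3)

/-- Singular expansion of `F` at `y`: the exponents `a 0 < a 1 < ⋯` are real and only finitely many
of them lie below any given bound; with `r = ‖x - y‖` and `n = (x - y) / r`, for every natural `N`,
`F x = ∑_{a i ≤ N} r ^ (a i) * f i n + o(r ^ N)` as `x → y`, `x ≠ y`.
Here `m` is the number of indices `i` with `a i ≤ N`, which are then `0, …, m - 1`.
Only the values of `f i` on the unit sphere matter. -/
def IsSingularExpansion (F : Space → ℝ) (y : Space) (a : ℕ → ℝ) (f : ℕ → Space → ℝ) : Prop :=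
  StrictMono a ∧
  ∀ N : ℕ, ∃ m : ℕ, (∀ i, i < m ↔ a i ≤ (N : ℝ)) ∧
    (fun x => F x - ∑ i ∈ Finset.range m, ‖x - y‖ ^ a i * f i (‖x - y‖⁻¹ • (x - y)))
      =o[𝓝[≠] y] (fun x => ‖x - y‖ ^ N)

/-- The class of real functions that are smooth outside `y₁`, `y₂` and have singular expansions
at these two points. -/
structure MemClass (y₁ y₂ : Space) (F : Space → ℝ) : Prop where
  smooth : ContDiffOn ℝ ((⊤ : ℕ∞) : WithTop ℕ∞) F {y₁, y₂}ᶜ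
  expansion₁ : ∃ a f, IsSingularExpansion F y₁ a f
  expansion₂ : ∃ b g, IsSingularExpansion F y₂ b g

/-- Summability at infinity with some room: `‖x‖ ^ ε * F x` is integrable near infinity for
some `ε > 0`. This holds in particular if `F = O(‖x‖ ^ (-3 - ε'))` with `ε' > 0`. -/
def SummableAtInfinity (F : Space → ℝ) : Prop :=
  ∃ ε : ℝ, 0 < ε ∧ IntegrableAtFilter (fun x => ‖x‖ ^ ε * F x) (cocompact Space) volume

/-- Integral over the unit sphere with respect to solid angle (total mass `4π`). -/
def angularIntegral (f : Space → ℝ) : ℝ :=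
  ∫ n : Metric.sphere (0 : Space) 1, f n ∂(volume : Measure Space).toSphere

/-- The counterterms of one singularity, with length scale `σ`:
`∑_{a + 3 < 0} s ^ (a + 3) / (a + 3) ∫ f_a dΩ + ln (s / σ) ∫ f_{-3} dΩ`.
The last term is present only if `-3` is among the exponents. -/
def counterterm (a : ℕ → ℝ) (f : ℕ → Space → ℝ) (σ s : ℝ) : ℝ :=
  (∑ᶠ (i : ℕ) (_ : a i + 3 < 0), s ^ (a i + 3) / (a i + 3) * angularIntegral (f i)) +
    ∑ᶠ (i : ℕ) (_ : a i = -3), Real.log (s / σ) * angularIntegral (f i)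

/-- `P` is the Hadamard partie finie `Pf_{s₁,s₂} ∫ F` of a function of the class. The coefficients of
an expansion are unique up to terms with zero coefficient, so the choice of the expansions does
not matter; the limit is required for all choices. -/
def HasPartieFinie (y₁ y₂ : Space) (s₁ s₂ : ℝ) (F : Space → ℝ) (P : ℝ) : Prop :=
  ∀ (a : ℕ → ℝ) (f : ℕ → Space → ℝ) (b : ℕ → ℝ) (g : ℕ → Space → ℝ),
    IsSingularExpansion F y₁ a f → IsSingularExpansion F y₂ b g →
    Tendsto (fun s : ℝ =>
      (∫ x in (Metric.closedBall y₁ s ∪ Metric.closedBall y₂ s)ᶜ, F x) +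
        counterterm a f s₁ s + counterterm b g s₂ s) (𝓝[>] 0) (𝓝 P)

/-- The integrand `(r₁ / s₁) ^ α * (r₂ / s₂) ^ β * F`. -/
def integrand (y₁ y₂ : Space) (s₁ s₂ : ℝ) (F : Space → ℝ) (α β : ℂ) (x : Space) : ℂ :=
  ((‖x - y₁‖ / s₁ : ℝ) : ℂ) ^ α * ((‖x - y₂‖ / s₂ : ℝ) : ℂ) ^ β * (F x : ℂ)

/-- `J` is the analytic continuation of `(z, w) ↦ ∫_B h z w`: the integral converges absolutely for
`Re z` large and all `w`, and `J` agrees with it there and is analytic in both variables on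
`(ℂ ∖ D) × ℂ` for some closed discrete `D ⊆ ℂ`. As `(ℂ ∖ D) × ℂ` is connected, `J` is unique there. -/
def IsContinuation (h : ℂ → ℂ → Space → ℂ) (B : Set Space) (J : ℂ → ℂ → ℂ) : Prop :=
  ∃ D : Set ℂ, Dᶜ ∈ codiscrete ℂ ∧
    AnalyticOnNhd ℂ (fun p : ℂ × ℂ => J p.1 p.2) {p | p.1 ∉ D} ∧
    ∃ A : ℝ, ∀ z w : ℂ, A < z.re →
      z ∉ D ∧ IntegrableOn (h z w) B ∧ J z w = ∫ x in B, h z w x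

/-- `J` is the analytic continuation, to a set `{0 < |α| < δ, 0 < |β| < δ}`, of
`I α β = ∫ (r₁ / s₁) ^ α * (r₂ / s₂) ^ β * F`. There may be no `(α, β)` for which the integral over
the whole space converges, so it is split into the ball `r₁ ≤ s`, continued in `α` from large
`Re α`, the ball `r₂ ≤ s`, continued in `β` from large `Re β`, and the rest of the space, where it
converges for `(α, β)` near the origin. -/
def IsContinuedIntegral (y₁ y₂ : Space) (s₁ s₂ : ℝ) (F : Space → ℝ) (J : ℂ → ℂ → ℂ) : Prop :=
  ∃ s : ℝ, 0 < s ∧ s < ‖y₁ - y₂‖ / 2 ∧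
  ∃ J₁ J₂ : ℂ → ℂ → ℂ,
    IsContinuation (fun α β => integrand y₁ y₂ s₁ s₂ F α β) (Metric.closedBall y₁ s) J₁ ∧
    IsContinuation (fun β α => integrand y₁ y₂ s₁ s₂ F α β) (Metric.closedBall y₂ s)
      (fun β α => J₂ α β) ∧
    ∃ δ : ℝ, 0 < δ ∧
      (∀ α β : ℂ, ‖α‖ < δ → ‖β‖ < δ →
        IntegrableOn (integrand y₁ y₂ s₁ s₂ F α β)
          (Metric.closedBall y₁ s ∪ Metric.closedBall y₂ s)ᶜ) ∧
      ∀ α β : ℂ, 0 < ‖α‖ → ‖α‖ < δ → 0 < ‖β‖ → ‖β‖ < δ →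
        J α β = J₁ α β + J₂ α β +
          ∫ x in (Metric.closedBall y₁ s ∪ Metric.closedBall y₂ s)ᶜ,
            integrand y₁ y₂ s₁ s₂ F α β x

/-- `h` has a Laurent expansion at `0` with finite principal part and with zeroth coefficient `c`:
near `0`, `h z = ∑_{k < m} q k / z ^ (k + 1) + g z` with `g` analytic at `0` and `g 0 = c`. -/
def HasFinitePart (h : ℂ → ℂ) (c : ℂ) : Prop :=
  ∃ (m : ℕ) (q : ℕ → ℂ) (g : ℂ → ℂ), AnalyticAt ℂ g 0 ∧ g 0 = c ∧
    ∀ᶠ z in 𝓝[≠] (0 : ℂ), h z = (∑ k ∈ Finset.range m, q k / z ^ (k + 1)) + g z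

/-- `c` is the iterated finite part `FP_{w → 0} { FP_{z → 0} J z w }`: first in `z` for fixed small
`w ≠ 0`, then in `w`. -/
def HasIteratedFinitePart (J : ℂ → ℂ → ℂ) (c : ℂ) : Prop :=
  ∃ G : ℂ → ℂ, (∀ᶠ w in 𝓝[≠] (0 : ℂ), HasFinitePart (fun z => J z w) (G w)) ∧ HasFinitePart G c

end HadamardPf

end

noncomputable section

namespace HadamardPf

/-! Near `y₁` write `F` as finitely many terms `r₁ ^ aᵢ fᵢ(n₁)` plus a remainder, and expand `(r₂ /
s₂) ^ β` in powers of `r₁`, with coefficients entire in `β`. The product is a finite sum of terms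
`r₁ ^ (aᵢ + k)` times a function of direction, plus a remainder `O(r₁ ^ N)` locally uniformly in
`β`. Over a ball of radius `s` each explicit term integrates in polar coordinates to `(s / s₁) ^ α s
^ (e + 3) / (α + e + 3)` with `e = aᵢ + k`, times an angular integral entire in `β`; the remainder
gives an analytic function for `Re α > -N - 3`. This yields the continuation, with at most a simple
pole at `α = 0`, coming from `e = -3`.

With the mirror computation at `y₂` and analyticity of the outer integral near the origin, the
continued integral is `γ₁(β) / α + γ₂(α) / β + g(α, β)` with `γ₁`, `γ₂`, `g` analytic at the origin.
Either iterated finite part of such a function is `g(0, 0)`. At `β = 0` only `k = 0` survives in the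
expansion at `y₁`, so `g(0, 0)` is the outer integral of `F` plus, for each ball, the finite parts
`s ^ (a + 3) / (a + 3)` or `ln (s / σ)` times angular integrals and the integral of the remainder.
This number does not depend on `s`: shrinking a ball transfers exactly the integral over a shell. As
`s → 0` the terms with `a > -3` and the remainder disappear, and what is left is the Hadamard
expression.

The carrying lemmas are `IsSingularExpansion.continuous_coeff` (the coefficients, about which
nothing is assumed, are continuous), `isEntireFamily_productRemainder`,
`ballContinuation_eq_pole_add`, `hasIteratedFinitePart_of_simple_poles`, `partieFinieAt_eq` and
`tendsto_ballFinitePart_sub_counterterm`. Uniqueness of the continuation, from the identity theorem,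
extends the result to every admissible `J`. -/

/-! ### Analyticity of parametric integrals in one and two complex variables -/

/-- A function on a polydisc that is continuous and separately holomorphic is analytic at the
centre. -/
theorem analyticAt_of_continuousOn_of_separately {f : ℂ × ℂ → ℂ} {z₀ w₀ : ℂ} {R : ℝ} (hR : 0 < R)
    (hc : ContinuousOn f (Metric.closedBall z₀ R ×ˢ Metric.closedBall w₀ R))
    (h₁ : ∀ w ∈ Metric.closedBall w₀ R,
      DifferentiableOn ℂ (fun z => f (z, w)) (Metric.ball z₀ R))
    (h₂ : ∀ z ∈ Metric.closedBall z₀ R,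
      DifferentiableOn ℂ (fun w => f (z, w)) (Metric.ball w₀ R)) :
    AnalyticAt ℂ f (z₀, w₀) := by
  -- The plan is to separate the variables in Cauchy's formula in `z`: the values of `f` on the
  -- circle around `z₀` form a map `Φ` of `w` into the Banach algebra `C(X, ℂ)`, the Cauchy kernel
  -- is a map `κ` of `z` into the same algebra, and `f (z, w)` is a bounded linear functional of `κ
  -- z * Φ w`.
  let X : Set ℝ := Set.Icc 0 (2 * Real.pi)
  have hcirc (θ : ℝ) : circleMap z₀ R θ ∈ Metric.closedBall z₀ R :=
    circleMap_mem_closedBall z₀ hR.le θ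
  let g : C(Metric.closedBall w₀ R, C(X, ℂ)) := ContinuousMap.curry
    ⟨fun p => f (circleMap z₀ R p.2, p.1), by
      refine hc.comp_continuous (by fun_prop) fun p => ⟨hcirc _, p.1.2⟩⟩
  classical
  let Φ : ℂ → C(X, ℂ) := fun w => if h : w ∈ Metric.closedBall w₀ R then g ⟨w, h⟩ else 0
  have hΦ : ∀ w ∈ Metric.closedBall w₀ R, ∀ θ : X, Φ w θ = f (circleMap z₀ R θ, w) := by
    intro w hw θ
    simp only [Φ, dif_pos hw]
    rfl
  have hΦc : ContinuousOn Φ (Metric.closedBall w₀ R) := by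
    rw [continuousOn_iff_continuous_domRestrict]
    convert g.continuous using 1
    ext1 w
    simp only [Set.domRestrict_apply, Φ, dif_pos w.2]
  have hΦi : CircleIntegrable Φ w₀ R :=
    (hΦc.mono Metric.sphere_subset_closedBall).circleIntegrable hR.le
  have hΦa : AnalyticAt ℂ Φ w₀ := by
    lift R to NNReal using hR.le
    have := (hasFPowerSeriesOn_cauchy_integral hΦi (by exact_mod_cast hR)).analyticAt
    refine this.congr ?_
    filter_upwards [Metric.ball_mem_nhds w₀ hR] with w hw
    -- The Banach-valued Cauchy integral reproduces `Φ w` because it does so at each `θ`, where it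
    -- is the scalar Cauchy formula in the second variable.
    ext θ
    have hint : CircleIntegrable (fun z => (z - w)⁻¹ • Φ z) w₀ R := by
      refine ContinuousOn.circleIntegrable hR.le (ContinuousOn.smul (ContinuousOn.inv₀
        (f := fun z => z - w) (by fun_prop) fun z hz => ?_)
        (hΦc.mono Metric.sphere_subset_closedBall))
      rw [sub_ne_zero]
      rintro rfl
      exact (Metric.mem_ball.1 hw).ne (Metric.mem_sphere.1 hz)
    have hev : (∮ z in C(w₀, R), (z - w)⁻¹ • Φ z) θ
        = ∮ z in C(w₀, R), (z - w)⁻¹ • f (circleMap z₀ R θ, z) := by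
      have h1 := (ContinuousMap.evalCLM ℂ θ).intervalIntegral_comp_comm hint.out
      rw [circleIntegral, circleIntegral]
      refine (h1.symm.trans ?_)
      refine intervalIntegral.integral_congr fun t _ => ?_
      simp [hΦ _ (circleMap_mem_closedBall w₀ hR.le t)]
    rw [ContinuousMap.smul_apply, hev, hΦ w (Metric.ball_subset_closedBall hw)]
    refine Complex.two_pi_I_inv_smul_circleIntegral_sub_inv_smul_of_differentiable_on_off_countable
      (f := fun w => f (circleMap z₀ R θ, w)) Set.countable_empty hw ?_ ?_
    · exact hc.comp (by fun_prop) fun z hz => ⟨hcirc _, hz⟩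
    · intro x hx
      exact (h₂ _ (hcirc _)).differentiableAt (Metric.isOpen_ball.mem_nhds hx.1)
  let ι : C(X, ℂ) := ⟨fun θ => circleMap z₀ R θ, by fun_prop⟩
  let d : C(X, ℂ) := ⟨fun θ => deriv (circleMap z₀ R) θ, by
    simp only [deriv_circleMap]; fun_prop⟩
  -- Writing the kernel as a ring inverse makes its analyticity that of inversion in a Banach
  -- algebra.
  let κ : ℂ → C(X, ℂ) := fun z => Ring.inverse (ι - z • (1 : C(X, ℂ)))
  have hκu : ∀ z ∈ Metric.ball z₀ R, IsUnit (ι - z • (1 : C(X, ℂ))) := by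
    intro z hz
    rw [ContinuousMap.isUnit_iff_forall_ne_zero]
    intro θ
    simp only [ContinuousMap.sub_apply, ContinuousMap.smul_apply, ContinuousMap.one_apply,
      smul_eq_mul, mul_one, sub_ne_zero]
    intro h
    rw [← h] at hz
    have : circleMap z₀ R (θ : ℝ) ∈ Metric.sphere z₀ R := circleMap_mem_sphere z₀ hR.le θ
    exact (Metric.mem_ball.1 hz).ne (Metric.mem_sphere.1 this)
  have hκ : ∀ z ∈ Metric.ball z₀ R, ∀ θ : X, κ z θ = (circleMap z₀ R θ - z)⁻¹ := by
    intro z hz θ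
    have h1 := congrArg (fun u : C(X, ℂ) => u θ) (Ring.inverse_mul_cancel _ (hκu z hz))
    refine eq_inv_of_mul_eq_one_left ?_
    simpa [κ, ι] using h1
  have hκa : AnalyticAt ℂ κ z₀ := by
    obtain ⟨u, hu⟩ := hκu z₀ (Metric.mem_ball_self hR)
    have h1 := analyticAt_inverse (𝕜 := ℂ) u
    rw [hu] at h1
    exact h1.comp (f := fun z : ℂ => ι - z • (1 : C(X, ℂ))) (by fun_prop)
  let ν : Measure X := Measure.comap Subtype.val volume
  have hν : IsFiniteMeasure ν := ⟨by
    rw [comap_subtype_coe_apply measurableSet_Icc]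
    simpa [X] using! measure_Icc_lt_top⟩
  have hint (u : C(X, ℂ)) : Integrable u ν :=
    Integrable.of_bound u.continuous.aestronglyMeasurable ‖u‖
      (Eventually.of_forall fun θ => u.norm_coe_le_norm θ)
  let T : C(X, ℂ) →L[ℂ] ℂ := LinearMap.mkContinuous
    { toFun := fun u => ∫ θ : X, u θ ∂ν
      map_add' := fun u v => integral_add (hint u) (hint v)
      map_smul' := fun c u => integral_const_mul c _ } (ν.real Set.univ) (by
        intro u
        exact (norm_integral_le_of_norm_le_const
          (Eventually.of_forall fun θ => u.norm_coe_le_norm θ)).trans_eq (mul_comm _ _))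
  have key : AnalyticAt ℂ (fun p : ℂ × ℂ => (2 * Real.pi * Complex.I : ℂ)⁻¹ *
      T (d * (κ p.1 * Φ p.2))) (z₀, w₀) := by
    have hκ' : AnalyticAt ℂ (fun p : ℂ × ℂ => κ p.1) (z₀, w₀) :=
      AnalyticAt.comp (f := Prod.fst) (x := (z₀, w₀)) hκa analyticAt_fst
    have hΦ' : AnalyticAt ℂ (fun p : ℂ × ℂ => Φ p.2) (z₀, w₀) :=
      AnalyticAt.comp (f := Prod.snd) (x := (z₀, w₀)) hΦa analyticAt_snd
    exact analyticAt_const.mul ((T.analyticAt _).comp (analyticAt_const.mul (hκ'.mul hΦ')))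
  refine key.congr ?_
  rw [nhds_prod_eq]
  filter_upwards [prod_mem_prod (Metric.ball_mem_nhds z₀ hR) (Metric.ball_mem_nhds w₀ hR)]
    with p hp
  have hp2 := Metric.ball_subset_closedBall hp.2
  have := Complex.two_pi_I_inv_smul_circleIntegral_sub_inv_smul_of_differentiable_on_off_countable
      (f := fun z => f (z, p.2)) Set.countable_empty hp.1
      (hc.comp (by fun_prop) fun z hz => ⟨hz, hp2⟩)
      (fun x hx => (h₁ _ hp2).differentiableAt (Metric.isOpen_ball.mem_nhds hx.1))
  refine Eq.trans ?_ this
  rw [smul_eq_mul]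
  congr 1
  rw [circleIntegral, intervalIntegral.integral_of_le Real.two_pi_pos.le,
    ← integral_Icc_eq_integral_Ioc]
  change ∫ θ : X, (d * (κ p.1 * Φ p.2)) θ ∂ν = _
  rw [← integral_subtype_comap measurableSet_Icc]
  refine integral_congr_ae (Eventually.of_forall fun θ => ?_)
  simp only [ContinuousMap.mul_apply, hκ _ hp.1, hΦ _ hp2, smul_eq_mul]
  rfl

/-- Holomorphy of a dominated parametric integral. -/
theorem differentiableAt_integral_of_dominated {X : Type*} [MeasurableSpace X] {μ : Measure X}
    {H : ℂ → X → ℂ} {z₀ : ℂ} {V : Set ℂ} (hV : V ∈ 𝓝 z₀) {g : X → ℝ}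
    (hm : ∀ z ∈ V, AEStronglyMeasurable (H z) μ)
    (hd : ∀ᵐ x ∂μ, ∀ z ∈ V, DifferentiableAt ℂ (fun z => H z x) z)
    (hg : Integrable g μ) (hb : ∀ᵐ x ∂μ, ∀ z ∈ V, ‖H z x‖ ≤ g x) :
    DifferentiableAt ℂ (fun z => ∫ x, H z x ∂μ) z₀ := by
  obtain ⟨ρ, hρ, hρV⟩ := Metric.nhds_basis_closedBall.mem_iff.1 hV
  have hz₀ : z₀ ∈ V := mem_of_mem_nhds hV
  have hρ2 : 0 < ρ / 2 := half_pos hρ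
  have hsub : ∀ z ∈ Metric.ball z₀ (ρ / 2), Metric.closedBall z (ρ / 2) ⊆ V := by
    intro z hz
    refine (Metric.closedBall_subset_closedBall' ?_).trans hρV
    linarith [Metric.mem_ball.1 hz]
  -- Cauchy's estimate on circles of radius `ρ / 2` turns the bound `g` on the integrand into the
  -- bound `g / (ρ / 2)` on its derivative.
  refine (hasDerivAt_integral_of_dominated_loc_of_deriv_le (bound := fun x => g x / (ρ / 2))
    (F' := fun z x => deriv (fun z => H z x) z) (Metric.ball_mem_nhds z₀ hρ2)
    (eventually_of_mem hV hm) ?_ ?_ ?_ (hg.div_const _) ?_).2.differentiableAt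
  · exact hg.mono' (hm z₀ hz₀) (hb.mono fun x hx => hx z₀ hz₀)
  -- The derivative at `z₀` is measurable as an almost everywhere limit of difference quotients
  -- along a sequence of steps.
  · obtain ⟨u, -, hu, hu0⟩ := exists_seq_strictAnti_tendsto' hρ
    have huV : ∀ n, z₀ + (u n : ℂ) ∈ V := fun n => hρV (by
      simpa [abs_of_pos (hu n).1] using (hu n).2.le)
    refine aestronglyMeasurable_of_tendsto_ae atTop
      (f := fun n => ((u n : ℂ))⁻¹ • (H (z₀ + u n) - H z₀))
      (fun n => ((hm _ (huV n)).sub (hm _ hz₀)).const_smul _) ?_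
    filter_upwards [hd] with x hx
    have h1 := (hx z₀ hz₀).hasDerivAt.tendsto_slope_zero
    refine h1.comp (tendsto_nhdsWithin_iff.2 ⟨?_, Eventually.of_forall fun n => ?_⟩)
    · exact_mod_cast (Complex.continuous_ofReal.tendsto 0).comp hu0
    · simpa using (hu n).1.ne'
  · filter_upwards [hd, hb] with x hx hbx z hz
    refine Complex.norm_deriv_le_of_forall_mem_sphere_norm_le hρ2 ?_ ?_
    · refine DifferentiableOn.diffContOnCl_ball (U := Metric.closedBall z (ρ / 2)) ?_ le_rfl
      exact fun w hw => (hx w (hsub z hz hw)).differentiableWithinAt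
    · exact fun w hw => hbx w (hsub z hz (Metric.sphere_subset_closedBall hw))
  · filter_upwards [hd] with x hx z hz
    exact (hx z (hsub z hz (Metric.mem_closedBall_self hρ2.le))).hasDerivAt

/-- Joint analyticity of a dominated parametric integral in two complex variables. -/
theorem analyticAt_integral_of_dominated {X : Type*} [MeasurableSpace X] {μ : Measure X}
    {H : ℂ × ℂ → X → ℂ} {p₀ : ℂ × ℂ} {V : Set (ℂ × ℂ)} (hV : V ∈ 𝓝 p₀) {g : X → ℝ}
    (hm : ∀ p ∈ V, AEStronglyMeasurable (H p) μ)
    (hd : ∀ᵐ x ∂μ, ∀ p ∈ V, DifferentiableAt ℂ (fun p => H p x) p)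
    (hg : Integrable g μ) (hb : ∀ᵐ x ∂μ, ∀ p ∈ V, ‖H p x‖ ≤ g x) :
    AnalyticAt ℂ (fun p => ∫ x, H p x ∂μ) p₀ := by
  obtain ⟨ρ, hρ, hρV⟩ := Metric.nhds_basis_ball.mem_iff.1 hV
  have hsub : Metric.ball p₀.1 ρ ×ˢ Metric.ball p₀.2 ρ ⊆ V := by
    rw [ball_prod_same]
    exact hρV
  have hρ2 : ρ / 2 < ρ := half_lt_self hρ
  have hcb (z : ℂ) : Metric.closedBall z (ρ / 2) ⊆ Metric.ball z ρ :=
    Metric.closedBall_subset_ball hρ2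
  have hnhds : ∀ p ∈ Metric.ball p₀.1 ρ ×ˢ Metric.ball p₀.2 ρ, V ∈ 𝓝 p := fun p hp =>
    mem_of_superset ((Metric.isOpen_ball.prod Metric.isOpen_ball).mem_nhds hp) hsub
  refine analyticAt_of_continuousOn_of_separately (half_pos hρ) ?_ ?_ ?_
  · intro p hp
    refine ContinuousAt.continuousWithinAt ?_
    have hpV := hnhds p ⟨hcb _ hp.1, hcb _ hp.2⟩
    refine continuousAt_of_dominated (bound := g) (eventually_of_mem hpV hm)
      (eventually_of_mem hpV fun q hq => hb.mono fun x hx => hx q hq) hg ?_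
    exact hd.mono fun x hx => (hx p (mem_of_mem_nhds hpV)).continuousAt
  · intro w hw z hz
    refine DifferentiableAt.differentiableWithinAt ?_
    have hpV := hnhds (z, w) ⟨hcb _ (Metric.ball_subset_closedBall hz), hcb _ hw⟩
    have hW : {z' : ℂ | (z', w) ∈ V} ∈ 𝓝 z := (by fun_prop : Continuous fun z' : ℂ =>
      (z', w)).continuousAt.preimage_mem_nhds hpV
    refine differentiableAt_integral_of_dominated (H := fun z' x => H (z', w) x) hW
      (fun z' h => hm _ h) ?_ hg (hb.mono fun x hx z' h => hx _ h)
    filter_upwards [hd] with x hx z' h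
    exact (hx (z', w) h).comp (f := fun z' : ℂ => (z', w)) z' (by fun_prop)
  · intro z hz w hw
    refine DifferentiableAt.differentiableWithinAt ?_
    have hpV := hnhds (z, w) ⟨hcb _ hz, hcb _ (Metric.ball_subset_closedBall hw)⟩
    have hW : {w' : ℂ | (z, w') ∈ V} ∈ 𝓝 w := (by fun_prop : Continuous fun w' : ℂ =>
      (z, w')).continuousAt.preimage_mem_nhds hpV
    refine differentiableAt_integral_of_dominated (H := fun w' x => H (z, w') x) hW
      (fun z' h => hm _ h) ?_ hg (hb.mono fun x hx z' h => hx _ h)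
    filter_upwards [hd] with x hx w' h
    exact (hx (z, w') h).comp (f := fun w' : ℂ => (z, w')) w' (by fun_prop)

/-! ### Uniqueness and gluing of analytic continuations -/

theorem countable_of_compl_mem_codiscrete {D : Set ℂ} (hD : Dᶜ ∈ codiscrete ℂ) : D.Countable :=
  (HereditarilyLindelofSpace.isLindelof _).countable_of_isDiscrete
    (compl_mem_codiscrete_iff.1 hD).2

/-- An open half-plane remains connected when countably many points are removed. -/
theorem isPreconnected_halfPlane_diff {D : Set ℂ} (hD : D.Countable) (A : ℝ) :
    IsPreconnected {z : ℂ | A < z.re ∧ z ∉ D} := by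
  -- `e` maps the plane continuously and bijectively onto the half-plane, which reduces the claim to
  -- the plane minus a countable set.
  let e : ℂ → ℂ := fun z => ⟨Real.exp z.re + A, z.im⟩
  have hec : Continuous e := by
    have : e = fun z => (Real.exp z.re + A : ℝ) + z.im * Complex.I := by
      ext1 z
      exact Complex.mk_eq_add_mul_I _ _
    rw [this]
    fun_prop
  have he : Function.Injective e := by
    intro z w h
    have h1 := congrArg Complex.re h
    have h2 := congrArg Complex.im h
    simp [e] at h1 h2
    exact Complex.ext h1 h2
  have h1 : IsPreconnected (e ⁻¹' D)ᶜ :=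
    ((hD.preimage_of_injOn he.injOn).isConnected_compl_of_one_lt_rank (by simp)).isPreconnected
  convert h1.image e hec.continuousOn using 1
  ext z
  constructor
  · rintro ⟨hz, hzD⟩
    have hez : e ⟨Real.log (z.re - A), z.im⟩ = z := by
      apply Complex.ext <;> simp [e, Real.exp_log (sub_pos.2 hz)]
    exact ⟨_, by rwa [Set.mem_compl_iff, Set.mem_preimage, hez], hez⟩
  · rintro ⟨w, hw, rfl⟩
    exact ⟨by simp [e, Real.exp_pos], hw⟩

theorem isOpen_halfPlane_diff {D : Set ℂ} (hD : Dᶜ ∈ codiscrete ℂ) (A : ℝ) :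
    IsOpen {z : ℂ | A < z.re ∧ z ∉ D} :=
  (isOpen_lt continuous_const Complex.continuous_re).inter (mem_codiscrete'.1 hD).1

/-- Identity theorem on a half-plane with a closed discrete set removed. -/
theorem eqOn_halfPlane_of_eq_of_re_large {D : Set ℂ} (hD : Dᶜ ∈ codiscrete ℂ) {A B : ℝ}
    {f g : ℂ → ℂ} (hf : AnalyticOnNhd ℂ f {z | A < z.re ∧ z ∉ D})
    (hg : AnalyticOnNhd ℂ g {z | A < z.re ∧ z ∉ D})
    (h : ∀ z : ℂ, B < z.re → z ∉ D → f z = g z) : Set.EqOn f g {z | A < z.re ∧ z ∉ D} := by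
  have hc := countable_of_compl_mem_codiscrete hD
  obtain ⟨z₀, hz₀, hz₀D⟩ : ∃ z₀ : ℂ, z₀ ∈ {z : ℂ | max A B < z.re} ∧ z₀ ∈ Dᶜ :=
    (hc.dense_compl ℝ).exists_mem_open (isOpen_lt continuous_const Complex.continuous_re)
      ⟨((max A B + 1 : ℝ) : ℂ), by
        rw [Set.mem_ofPred_eq, Complex.ofReal_re]
        exact lt_add_one _⟩ |>.imp fun z hz => ⟨hz.2, hz.1⟩
  refine hf.eqOn_of_preconnected_of_eventuallyEq hg (isPreconnected_halfPlane_diff hc A)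
    (z₀ := z₀) ⟨(le_max_left _ _).trans_lt hz₀, hz₀D⟩ ?_
  filter_upwards [(isOpen_halfPlane_diff hD (max A B)).mem_nhds ⟨hz₀, hz₀D⟩] with z hz
  exact h z ((le_max_right _ _).trans_lt hz.1) hz.2

theorem analyticOnNhd_slice {J : ℂ → ℂ → ℂ} {D : Set ℂ} {A : ℝ} (w : ℂ)
    (hJ : AnalyticOnNhd ℂ (fun p : ℂ × ℂ => J p.1 p.2) {p | A < p.1.re ∧ p.1 ∉ D}) :
    AnalyticOnNhd ℂ (fun z => J z w) {z | A < z.re ∧ z ∉ D} := fun z hz =>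
  AnalyticAt.comp (f := fun z : ℂ => (z, w)) (hJ (z, w) hz) (by fun_prop)

/-- Two continuations of the same integral agree near the origin. -/
theorem IsContinuation.eventually_eq {h : ℂ → ℂ → Space → ℂ} {B : Set Space} {J J' : ℂ → ℂ → ℂ}
    (hJ : IsContinuation h B J) (hJ' : IsContinuation h B J') :
    ∀ᶠ z in 𝓝[≠] (0 : ℂ), ∀ w, J z w = J' z w := by
  obtain ⟨D, hD, ha, A, hA⟩ := hJ
  obtain ⟨D', hD', ha', A', hA'⟩ := hJ'
  have hDD : (D ∪ D')ᶜ ∈ codiscrete ℂ := by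
    rw [Set.compl_union]
    exact inter_mem hD hD'
  have h1 : (D ∪ D')ᶜ ∈ 𝓝[≠] (0 : ℂ) := by
    have := mem_codiscrete.1 hDD 0
    rwa [compl_compl, disjoint_principal_right] at this
  filter_upwards [h1] with z hz w
  -- The half-plane only has to contain the given point; agreement is known far to the right, where
  -- both functions equal the integral.
  refine eqOn_halfPlane_of_eq_of_re_large hDD (A := z.re - 1) (B := max A A')
    (f := fun z => J z w) (g := fun z => J' z w)
    (analyticOnNhd_slice w fun p hp => ha p fun h => hp.2 (Or.inl h))
    (analyticOnNhd_slice w fun p hp => ha' p fun h => hp.2 (Or.inr h)) ?_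
    ⟨sub_one_lt _, hz⟩
  intro z hz _
  rw [(hA z w ((le_max_left _ _).trans_lt hz)).2.2, (hA' z w ((le_max_right _ _).trans_lt hz)).2.2]

/-- Continuations to larger and larger half-planes glue to a continuation to the whole plane. -/
theorem exists_isContinuation_of_halfPlanes {h : ℂ → ℂ → Space → ℂ} {B : Set Space} {D : Set ℂ}
    (hD : Dᶜ ∈ codiscrete ℂ) {A : ℝ} (hAD : ∀ z : ℂ, A < z.re → z ∉ D)
    (hint : ∀ z w : ℂ, A < z.re → IntegrableOn (h z w) B) (J : ℕ → ℂ → ℂ → ℂ)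
    (hJ : ∀ N, AnalyticOnNhd ℂ (fun p : ℂ × ℂ => J N p.1 p.2) {p | -(N : ℝ) - 1 < p.1.re ∧ p.1 ∉ D})
    (hJi : ∀ N (z w : ℂ), A < z.re → J N z w = ∫ x in B, h z w x) :
    ∃ J' : ℂ → ℂ → ℂ, IsContinuation h B J' ∧
      ∀ (N : ℕ) (z w : ℂ), -(N : ℝ) - 1 < z.re → z ∉ D → J' z w = J N z w := by
  have hagree : ∀ (N M : ℕ) (z w : ℂ), -(N : ℝ) - 1 < z.re → -(M : ℝ) - 1 < z.re → z ∉ D →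
      J N z w = J M z w := by
    intro N M z w hN hM hz
    have hsub : ∀ K : ℕ, AnalyticOnNhd ℂ (fun p : ℂ × ℂ => J K p.1 p.2)
        {p | max (-(N : ℝ) - 1) (-(M : ℝ) - 1) < p.1.re ∧ p.1 ∉ D} →
        AnalyticOnNhd ℂ (fun z => J K z w) {z | max (-(N : ℝ) - 1) (-(M : ℝ) - 1) < z.re ∧ z ∉ D} :=
      fun K hK => analyticOnNhd_slice w hK
    refine eqOn_halfPlane_of_eq_of_re_large hD (B := A) (f := fun z => J N z w)
      (g := fun z => J M z w)
      (hsub N ((hJ N).mono fun p hp => ⟨(le_max_left _ _).trans_lt hp.1, hp.2⟩))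
      (hsub M ((hJ M).mono fun p hp => ⟨(le_max_right _ _).trans_lt hp.1, hp.2⟩))
      (fun z hz _ => by rw [hJi N z w hz, hJi M z w hz]) ⟨max_lt hN hM, hz⟩
  -- Any index whose half-plane contains `z` would do, since `hagree` makes the value independent of
  -- it. Near a point the glued function therefore coincides with one fixed `J N`, which gives
  -- analyticity despite the jumps of `n`.
  let n : ℂ → ℕ := fun z => ⌈|z.re|⌉₊
  have hn : ∀ z : ℂ, -(n z : ℝ) - 1 < z.re := by
    intro z
    have h1 := Nat.le_ceil |z.re|
    have h2 := neg_abs_le z.re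
    simp only [n]
    linarith
  refine ⟨fun z w => J (n z) z w, ⟨D, hD, ?_, A,
      fun z w hz => ⟨hAD z hz, hint z w hz, hJi _ z w hz⟩⟩,
    fun N z w hN hz => hagree _ _ z w (hn z) hN hz⟩
  intro p hp
  refine (hJ (n p.1) p ⟨hn _, hp⟩).congr ?_
  have hopen : IsOpen {q : ℂ × ℂ | -(n p.1 : ℝ) - 1 < q.1.re ∧ q.1 ∉ D} :=
    (isOpen_halfPlane_diff hD _).preimage continuous_fst
  filter_upwards [hopen.mem_nhds (show p ∈ _ from ⟨hn _, hp⟩)] with q hq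
  exact hagree _ _ _ _ hq.1 (hn _) hq.2

/-! ### Finite parts of Laurent expansions -/

/-- Multiplication by `z` shortens the principal part by one and makes `z * u z + r 0` the new
regular part, whose value at `0` is `r 0`; induction on the length then kills all coefficients.
Continuity of the regular part is all that is needed, and it survives the multiplication. -/
theorem eq_zero_of_principalPart_add_eq_zero (M : ℕ) (r : ℕ → ℂ) (u : ℂ → ℂ)
    (hu : ContinuousAt u 0)
    (h : ∀ᶠ z in 𝓝[≠] (0 : ℂ), (∑ k ∈ Finset.range M, r k / z ^ (k + 1)) + u z = 0) :
    (∀ k < M, r k = 0) ∧ u 0 = 0 := by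
  have hlim : ∀ v : ℂ → ℂ, ContinuousAt v 0 → (∀ᶠ z in 𝓝[≠] (0 : ℂ), v z = 0) → v 0 = 0 := by
    intro v hv hv0
    have h1 : Tendsto v (𝓝[≠] 0) (𝓝 (v 0)) := hv.tendsto.mono_left nhdsWithin_le_nhds
    exact tendsto_nhds_unique h1 (tendsto_const_nhds.congr' (hv0.mono fun _ hz => hz.symm))
  induction M generalizing r u with
  | zero => exact ⟨by simp, hlim u hu (by simpa using h)⟩
  | succ M ih =>
    have h1 := ih (fun k => r (k + 1)) (fun z => z * u z + r 0) (by fun_prop) (by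
      filter_upwards [h, self_mem_nhdsWithin] with z hz hz0
      have hz0 : z ≠ 0 := hz0
      rw [Finset.sum_range_succ'] at hz
      have h2 : (∑ k ∈ Finset.range M, r (k + 1) / z ^ (k + 1)) =
          z * ∑ k ∈ Finset.range M, r (k + 1) / z ^ (k + 1 + 1) := by
        rw [Finset.mul_sum]
        refine Finset.sum_congr rfl fun k _ => ?_
        field_simp
        ring
      rw [h2]
      field_simp at hz ⊢
      linear_combination hz)
    have hr : ∀ k < M + 1, r k = 0 := by
      intro k hk
      rcases k with _ | k
      · simpa using h1.2
      · exact h1.1 k (by omega)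
    refine ⟨hr, hlim u hu ?_⟩
    filter_upwards [h] with z hz
    rwa [Finset.sum_eq_zero fun k hk => by rw [hr k (Finset.mem_range.1 hk), zero_div],
      zero_add] at hz

/-- The two principal parts are padded with zeros to a common length, so that the difference of the
expansions vanishes near `0` and the preceding lemma applies. -/
theorem HasFinitePart.unique {h : ℂ → ℂ} {c c' : ℂ} (hc : HasFinitePart h c)
    (hc' : HasFinitePart h c') : c = c' := by
  obtain ⟨m, q, g, hg, rfl, hq⟩ := hc
  obtain ⟨m', q', g', hg', rfl, hq'⟩ := hc'
  have hext : ∀ (m : ℕ) (q : ℕ → ℂ) (M : ℕ) (z : ℂ), m ≤ M →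
      ∑ k ∈ Finset.range m, q k / z ^ (k + 1) =
        ∑ k ∈ Finset.range M, (if k < m then q k else 0) / z ^ (k + 1) := by
    intro m q M z hM
    rw [← Finset.sum_subset (Finset.range_mono hM)]
    · exact Finset.sum_congr rfl fun k hk => by rw [if_pos (Finset.mem_range.1 hk)]
    · intro k _ hk
      rw [if_neg (by simpa using hk), zero_div]
  have := (eq_zero_of_principalPart_add_eq_zero (max m m')
    (fun k => (if k < m then q k else 0) - (if k < m' then q' k else 0)) (fun z => g z - g' z)
    (hg.continuousAt.sub hg'.continuousAt) (by
      filter_upwards [hq, hq'] with z hz hz'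
      rw [hz, hext m q _ z (le_max_left _ _), hext m' q' _ z (le_max_right _ _)] at hz'
      simp only [sub_div, Finset.sum_sub_distrib]
      linear_combination hz')).2
  exact sub_eq_zero.1 this

theorem HasFinitePart.congr {h h' : ℂ → ℂ} {c : ℂ} (hc : HasFinitePart h c)
    (hh : ∀ᶠ z in 𝓝[≠] (0 : ℂ), h' z = h z) : HasFinitePart h' c := by
  obtain ⟨m, q, g, hg, hgc, hq⟩ := hc
  exact ⟨m, q, g, hg, hgc, by filter_upwards [hq, hh] with z hz hz'; rw [hz', hz]⟩

theorem hasFinitePart_div_add {g : ℂ → ℂ} (hg : AnalyticAt ℂ g 0) (q : ℂ) :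
    HasFinitePart (fun z => q / z + g z) (g 0) :=
  ⟨1, fun _ => q, g, hg, rfl, Eventually.of_forall fun z => by simp⟩

/-- The iterated finite parts of a function that has simple poles in each variable separately. -/
theorem hasIteratedFinitePart_of_simple_poles {J : ℂ → ℂ → ℂ} {γ₁ γ₂ : ℂ → ℂ} {g : ℂ × ℂ → ℂ}
    (hγ₂ : AnalyticAt ℂ γ₂ 0) (hg : AnalyticAt ℂ g (0, 0)) {δ : ℝ}
    (hδ : 0 < δ) (hJ : ∀ z w : ℂ, 0 < ‖z‖ → ‖z‖ < δ → 0 < ‖w‖ → ‖w‖ < δ →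
      J z w = γ₁ w / z + γ₂ z / w + g (z, w)) :
    HasIteratedFinitePart J (g (0, 0)) := by
  have hball : ∀ᶠ z in 𝓝[≠] (0 : ℂ), 0 < ‖z‖ ∧ ‖z‖ < δ := by
    filter_upwards [self_mem_nhdsWithin, nhdsWithin_le_nhds (Metric.ball_mem_nhds (0 : ℂ) hδ)]
      with z hz hz'
    exact ⟨norm_pos_iff.2 hz, by simpa using hz'⟩
  have hslice : ∀ᶠ w in 𝓝[≠] (0 : ℂ), AnalyticAt ℂ g (0, w) :=
    nhdsWithin_le_nhds ((by fun_prop : ContinuousAt (fun w : ℂ => ((0 : ℂ), w)) 0).eventually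
      hg.eventually_analyticAt)
  -- For fixed `w ≠ 0` the term `γ₁ w / z` is pure principal part in `z`, whatever `γ₁` is, while
  -- `γ₂ z / w` is analytic in `z` and leaves `γ₂ 0 / w`; that in turn is pure principal part in
  -- `w`.
  refine ⟨fun w => γ₂ 0 / w + g (0, w), ?_, ?_⟩
  · filter_upwards [hball, hslice] with w hw hgw
    have h1 : AnalyticAt ℂ (fun z => γ₂ z / w + g (z, w)) 0 :=
      (hγ₂.div analyticAt_const (norm_pos_iff.1 hw.1)).add
        (hgw.comp (f := fun z : ℂ => (z, w)) (by fun_prop))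
    refine (hasFinitePart_div_add h1 (γ₁ w)).congr ?_
    filter_upwards [hball] with z hz
    rw [hJ z w hz.1 hz.2 hw.1 hw.2, add_assoc]
  · exact hasFinitePart_div_add (hg.comp (f := fun w : ℂ => ((0 : ℂ), w)) (by fun_prop)) _

/-! ### Directions and polar coordinates around a point -/

/-- The unit vector pointing from `y` to `x`. -/
def dir (y x : Space) : Space := ‖x - y‖⁻¹ • (x - y)

theorem dir_mem_sphere {y x : Space} (h : x ≠ y) : dir y x ∈ Metric.sphere (0 : Space) 1 := by
  have : ‖x - y‖ ≠ 0 := norm_ne_zero_iff.2 (sub_ne_zero.2 h)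
  simp [dir, norm_smul, this]

theorem continuousOn_dir (y : Space) : ContinuousOn (dir y) {y}ᶜ := by
  unfold dir
  have h1 : ContinuousOn (fun x : Space => ‖x - y‖⁻¹) {y}ᶜ :=
    ContinuousOn.inv₀ (f := fun x : Space => ‖x - y‖) (by fun_prop) fun x hx =>
      norm_ne_zero_iff.2 (sub_ne_zero.2 hx)
  exact h1.smul (by fun_prop)

theorem continuousOn_comp_dir {E : Type*} [TopologicalSpace E] {g : Space → E} (y : Space)
    (hg : Continuous fun n : Metric.sphere (0 : Space) 1 => g n) :
    ContinuousOn (fun x => g (dir y x)) {y}ᶜ := by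
  have : ContinuousOn g (Metric.sphere 0 1) := continuousOn_iff_continuous_domRestrict.2 hg
  exact this.comp (continuousOn_dir y) fun x hx => dir_mem_sphere hx

theorem aestronglyMeasurable_of_continuousOn_compl_singleton {E : Type*} [TopologicalSpace E]
    [TopologicalSpace.PseudoMetrizableSpace E]
    {g : Space → E} {y : Space} {B : Set Space} (hB : MeasurableSet B)
    (hg : ContinuousOn g (B \ {y})) : AEStronglyMeasurable g (volume.restrict B) := by
  have h1 := hg.aestronglyMeasurable (μ := volume) (hB.diff (measurableSet_singleton y))
  rwa [Measure.restrict_congr_set (sdiff_null_ae_eq_self (measure_singleton y))] at h1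

section Polar

variable {𝕜 : Type*} [RCLike 𝕜]

theorem integral_polar (ψ : ℝ → 𝕜) (g : Space → 𝕜) :
    ∫ x : Space, ψ ‖x‖ * g (‖x‖⁻¹ • x) =
      (∫ r in Set.Ioi (0 : ℝ), r ^ 2 • ψ r) *
        ∫ n : Metric.sphere (0 : Space) 1, g n ∂(volume : Measure Space).toSphere := by
  calc
    _ = ∫ x : ({(0)}ᶜ : Set Space), ψ ‖x.1‖ * g (‖x.1‖⁻¹ • x.1)
        ∂((volume : Measure Space).comap Subtype.val) := by
      rw [integral_subtype_comap (measurableSet_singleton _).compl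
        fun x : Space ↦ ψ ‖x‖ * g (‖x‖⁻¹ • x), restrict_compl_singleton]
    _ = ∫ x, g x.1 * ψ x.2 ∂(volume : Measure Space).toSphere.prod (.volumeIoiPow 2) := by
      have := (volume : Measure Space).measurePreserving_homeomorphUnitSphereProd.integral_comp
        (Homeomorph.measurableEmbedding _)
        (fun p : Metric.sphere (0 : Space) 1 × Set.Ioi (0 : ℝ) => g p.1 * ψ p.2)
      simp only [homeomorphUnitSphereProd_apply_fst_coe, homeomorphUnitSphereProd_apply_snd_coe,
        finrank_euclideanSpace, Fintype.card_fin, Nat.reduceSub] at this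
      rw [← this]
      simp only [mul_comm]
    _ = (∫ n : Metric.sphere (0 : Space) 1, g n ∂(volume : Measure Space).toSphere) *
          ∫ r : Set.Ioi (0 : ℝ), ψ r ∂.volumeIoiPow 2 :=
      integral_prod_mul (fun n : Metric.sphere (0 : Space) 1 => g n)
        fun r : Set.Ioi (0 : ℝ) => ψ r
    _ = _ := by
      rw [mul_comm]
      congr 1
      simp only [Measure.volumeIoiPow, ENNReal.ofReal]
      rw [integral_withDensity_eq_integral_smul,
        integral_subtype_comap measurableSet_Ioi fun a ↦ Real.toNNReal (a ^ 2) • ψ a,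
        setIntegral_congr_fun measurableSet_Ioi fun x hx ↦ ?_]
      · rw [NNReal.smul_def, Real.coe_toNNReal _ (pow_nonneg hx.out.le _)]
      · exact (measurable_subtype_coe.pow_const _).real_toNNReal

theorem integrable_polar {ψ : ℝ → 𝕜} {g : Space → 𝕜}
    (hψ : IntegrableOn (fun r : ℝ => r ^ 2 • ψ r) (Set.Ioi 0))
    (hg : Integrable (fun n : Metric.sphere (0 : Space) 1 => g n)
      (volume : Measure Space).toSphere) :
    Integrable (fun x : Space => ψ ‖x‖ * g (‖x‖⁻¹ • x)) := by
  have h1 : Integrable (fun r : Set.Ioi (0 : ℝ) => ψ r) (.volumeIoiPow 2) := by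
    rw [Measure.volumeIoiPow, integrable_withDensity_iff_integrable_smul' (by fun_prop) (by simp)]
    rw [integrableOn_iff_comap_subtypeVal measurableSet_Ioi] at hψ
    refine hψ.congr (Eventually.of_forall ?_)
    rintro ⟨x, hx : 0 < x⟩
    simp (disch := positivity) [ENNReal.toReal_ofReal]
  have h2 := hg.mul_prod h1
  have h3 := (volume : Measure Space).measurePreserving_homeomorphUnitSphereProd.integrable_comp_emb
    (Homeomorph.measurableEmbedding _)
    (g := fun p : Metric.sphere (0 : Space) 1 × Set.Ioi (0 : ℝ) => g p.1 * ψ p.2)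
  simp only [finrank_euclideanSpace, Fintype.card_fin, Nat.reduceSub] at h3
  rw [← restrict_compl_singleton (μ := (volume : Measure Space)) 0, ← IntegrableOn,
    integrableOn_iff_comap_subtypeVal (measurableSet_singleton _).compl]
  refine (h3.2 h2).congr (Eventually.of_forall fun x => ?_)
  simp [mul_comm]

/-- Polar coordinates around `y` on a union of spheres. -/
theorem setIntegral_polar (y : Space) {S : Set ℝ} (hS : MeasurableSet S) (ψ : ℝ → 𝕜)
    (g : Space → 𝕜) :
    ∫ x in {x : Space | ‖x - y‖ ∈ S}, ψ ‖x - y‖ * g (dir y x) =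
      (∫ r in Set.Ioi 0 ∩ S, r ^ 2 • ψ r) *
        ∫ n : Metric.sphere (0 : Space) 1, g n ∂(volume : Measure Space).toSphere := by
  have hm : MeasurableSet {x : Space | ‖x - y‖ ∈ S} := (by fun_prop : Measurable fun x : Space =>
    ‖x - y‖) hS
  rw [← integral_indicator hm]
  have h1 := integral_polar (S.indicator ψ) g
  rw [← integral_sub_right_eq_self _ y] at h1
  have h2 : ∀ r : ℝ, r ^ 2 • S.indicator ψ r = S.indicator (fun r => r ^ 2 • ψ r) r := by
    intro r
    by_cases h : r ∈ S <;> simp [h]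
  simp only [h2] at h1
  rw [setIntegral_indicator hS] at h1
  rw [← h1]
  refine integral_congr_ae (Eventually.of_forall fun x => ?_)
  by_cases h : ‖x - y‖ ∈ S <;> simp [h, dir, Set.indicator]

theorem integrableOn_polar (y : Space) {S : Set ℝ} (hS : MeasurableSet S) {ψ : ℝ → 𝕜}
    {g : Space → 𝕜} (hψ : IntegrableOn (fun r : ℝ => r ^ 2 • ψ r) (Set.Ioi 0 ∩ S))
    (hg : Integrable (fun n : Metric.sphere (0 : Space) 1 => g n)
      (volume : Measure Space).toSphere) :
    IntegrableOn (fun x => ψ ‖x - y‖ * g (dir y x)) {x : Space | ‖x - y‖ ∈ S} := by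
  have hm : MeasurableSet {x : Space | ‖x - y‖ ∈ S} := (by fun_prop : Measurable fun x : Space =>
    ‖x - y‖) hS
  rw [← integrable_indicator_iff hm]
  have h2 : ∀ r : ℝ, r ^ 2 • S.indicator ψ r = S.indicator (fun r => r ^ 2 • ψ r) r := by
    intro r
    by_cases h : r ∈ S <;> simp [h]
  have h1 := integrable_polar (ψ := S.indicator ψ) (g := g) (by
    simp only [h2]
    rwa [integrableOn_indicator_iff hS, Set.inter_comm]) hg
  refine (h1.comp_sub_right y).congr (Eventually.of_forall fun x => ?_)
  by_cases h : ‖x - y‖ ∈ S <;> simp [h, dir, Set.indicator]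

end Polar

theorem closedBall_eq_norm_sub (y : Space) (s : ℝ) :
    Metric.closedBall y s = {x : Space | ‖x - y‖ ∈ Set.Iic s} := by
  ext x
  simp [dist_eq_norm]

theorem integrableOn_rpow_closedBall (y : Space) (s : ℝ) {q : ℝ} (hq : -3 < q) :
    IntegrableOn (fun x : Space => ‖x - y‖ ^ q) (Metric.closedBall y s) := by
  rw [closedBall_eq_norm_sub]
  have := integrableOn_polar (𝕜 := ℝ) y (S := Set.Iic s) measurableSet_Iic (ψ := fun r => r ^ q)
    (g := fun _ => 1) ?_ (integrable_const _)
  · simpa using this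
  · rw [Set.Ioi_inter_Iic]
    have h1 := (intervalIntegral.intervalIntegrable_rpow' (a := 0) (b := s) (r := q + 2)
      (by linarith)).1
    refine h1.congr_fun (fun r hr => ?_) measurableSet_Ioc
    have : 0 < r := hr.1
    simp only [smul_eq_mul]
    rw [Real.rpow_add this, mul_comm]
    simp

/-! ### Explicit integrals of powers over a ball -/

/-- The radial integral `∫_{r ≤ s} (r / σ) ^ α r ^ e r² dr`. -/
def radialIntegral (σ s e : ℝ) (α : ℂ) : ℂ :=
  ((s / σ : ℝ) : ℂ) ^ α * ((s ^ (e + 3) : ℝ) : ℂ) / (α + ((e + 3 : ℝ) : ℂ))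

theorem cpow_mul_rpow {σ e r : ℝ} (hσ : 0 < σ) (hr : 0 < r) (α : ℂ) :
    r ^ 2 • (((r / σ : ℝ) : ℂ) ^ α * ((r ^ e : ℝ) : ℂ)) =
      ((σ : ℂ) ^ α)⁻¹ * (r : ℂ) ^ (α + ((e + 2 : ℝ) : ℂ)) := by
  have hr' : (r : ℂ) ≠ 0 := by exact_mod_cast hr.ne'
  rw [Complex.ofReal_div, Complex.div_cpow_ofReal_nonneg hr.le hσ.le]
  rw [Complex.cpow_add _ _ hr', Complex.ofReal_cpow hr.le, Complex.ofReal_add,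
    Complex.cpow_add _ _ hr', Complex.real_smul]
  norm_num
  ring

theorem setIntegral_closedBall_cpow (y : Space) {σ s e : ℝ} (hσ : 0 < σ) (hs : 0 < s) {α : ℂ}
    (hα : -(e + 3) < α.re) {g : Space → ℂ}
    (hg : Integrable (fun n : Metric.sphere (0 : Space) 1 => g n)
      (volume : Measure Space).toSphere) :
    IntegrableOn (fun x => ((‖x - y‖ / σ : ℝ) : ℂ) ^ α * ((‖x - y‖ ^ e : ℝ) : ℂ) * g (dir y x))
      (Metric.closedBall y s) ∧
    ∫ x in Metric.closedBall y s,
        ((‖x - y‖ / σ : ℝ) : ℂ) ^ α * ((‖x - y‖ ^ e : ℝ) : ℂ) * g (dir y x) =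
      radialIntegral σ s e α *
        ∫ n : Metric.sphere (0 : Space) 1, g n ∂(volume : Measure Space).toSphere := by
  have hre : -1 < (α + ((e + 2 : ℝ) : ℂ)).re := by simp; linarith
  have h0 : α + ((e + 3 : ℝ) : ℂ) ≠ 0 := by
    intro h
    have := congrArg Complex.re h
    simp at this
    linarith
  constructor
  · rw [closedBall_eq_norm_sub]
    refine integrableOn_polar y measurableSet_Iic
      (ψ := fun r => ((r / σ : ℝ) : ℂ) ^ α * ((r ^ e : ℝ) : ℂ)) ?_ hg
    rw [Set.Ioi_inter_Iic]
    have h1 := (intervalIntegral.intervalIntegrable_cpow' (a := 0) (b := s) hre).1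
    refine IntegrableOn.congr_fun (h1.const_mul ((σ : ℂ) ^ α)⁻¹) (fun r hr => ?_) measurableSet_Ioc
    exact (cpow_mul_rpow hσ hr.1 α).symm
  · rw [closedBall_eq_norm_sub, setIntegral_polar y measurableSet_Iic
      (fun r => ((r / σ : ℝ) : ℂ) ^ α * ((r ^ e : ℝ) : ℂ)) g]
    congr 1
    rw [Set.Ioi_inter_Iic, setIntegral_congr_fun measurableSet_Ioc
      fun r hr => cpow_mul_rpow hσ hr.1 α, integral_const_mul,
      ← intervalIntegral.integral_of_le hs.le, integral_cpow (Or.inl hre)]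
    have h3 : α + ((e + 2 : ℝ) : ℂ) + 1 = α + ((e + 3 : ℝ) : ℂ) := by push_cast; ring
    rw [h3, Complex.ofReal_zero, Complex.zero_cpow h0, radialIntegral, Complex.ofReal_div,
      Complex.div_cpow_ofReal_nonneg hs.le hσ.le,
      Complex.cpow_add _ _ (by exact_mod_cast hs.ne'), Complex.ofReal_cpow hs.le]
    ring

/-- On either side of base `1` one of the end exponents dominates. Adding the two gives a single
integrable majorant for all exponents in a strip. -/
theorem rpow_le_rpow_add_rpow {x a b t : ℝ} (hx : 0 < x) (ha : a ≤ t) (hb : t ≤ b) :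
    x ^ t ≤ x ^ a + x ^ b := by
  rcases le_total x 1 with h | h
  · exact (Real.rpow_le_rpow_of_exponent_ge hx h ha).trans
      (le_add_of_nonneg_right (Real.rpow_nonneg hx.le _))
  · exact (Real.rpow_le_rpow_of_exponent_le h hb).trans
      (le_add_of_nonneg_left (Real.rpow_nonneg hx.le _))

theorem norm_cpow_ofReal {x : ℝ} (hx : 0 < x) (α : ℂ) : ‖(x : ℂ) ^ α‖ = x ^ α.re :=
  Complex.norm_cpow_eq_rpow_re_of_pos hx α

theorem differentiable_const_cpow_ofReal {x : ℝ} (hx : 0 < x) :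
    Differentiable ℂ fun α : ℂ => (x : ℂ) ^ α := fun _ =>
  differentiableAt_id.const_cpow (Or.inl (Complex.ofReal_ne_zero.2 (ne_of_gt hx)))

/-! ### Remainder integrals depending on two complex parameters -/

/-- A family of functions on a punctured ball, entire in the parameter and `O(r ^ q)` locally
uniformly in it. -/
structure IsEntireFamily (y : Space) (s q : ℝ) (H : ℂ → Space → ℂ) : Prop where
  continuousOn : ∀ β, ContinuousOn (H β) (Metric.closedBall y s \ {y})
  differentiable : ∀ x ∈ Metric.closedBall y s \ {y}, Differentiable ℂ fun β => H β x
  bound : ∀ b : ℝ, ∃ C : ℝ, ∀ β : ℂ, ‖β‖ ≤ b → ∀ x ∈ Metric.closedBall y s \ {y},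
    ‖H β x‖ ≤ C * ‖x - y‖ ^ q

section EntireFamily

variable {y : Space} {s q σ : ℝ} {H : ℂ → Space → ℂ}

theorem ae_mem_closedBall_diff (y : Space) (s : ℝ) :
    ∀ᵐ x ∂(volume.restrict (Metric.closedBall y s)), x ∈ Metric.closedBall y s \ {y} := by
  filter_upwards [ae_restrict_mem Metric.isClosed_closedBall.measurableSet,
    ae_restrict_of_ae (Measure.ae_ne volume y)] with x hx hx'
  exact ⟨hx, hx'⟩

theorem IsEntireFamily.aestronglyMeasurable (hH : IsEntireFamily y s q H) (hσ : 0 < σ) (α β : ℂ) :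
    AEStronglyMeasurable (fun x => ((‖x - y‖ / σ : ℝ) : ℂ) ^ α * H β x)
      (volume.restrict (Metric.closedBall y s)) := by
  refine aestronglyMeasurable_of_continuousOn_compl_singleton (y := y)
    Metric.isClosed_closedBall.measurableSet (ContinuousOn.mul ?_ (hH.continuousOn β))
  intro x hx
  refine ContinuousAt.continuousWithinAt ?_
  have hpos : 0 < ‖x - y‖ / σ := div_pos (norm_pos_iff.2 (sub_ne_zero.2 hx.2)) hσ
  have h1 : ContinuousAt (fun z : ℂ => z ^ α) ((‖x - y‖ / σ : ℝ) : ℂ) :=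
    continuousAt_cpow_const (Or.inl (by simpa using hpos))
  exact h1.comp (f := fun x : Space => ((‖x - y‖ / σ : ℝ) : ℂ)) (by fun_prop)

/-- A common dominating function for parameters in a strip. -/
theorem IsEntireFamily.exists_dominating (hH : IsEntireFamily y s q H) (hσ : 0 < σ) {A B : ℝ}
    (hA : -q - 3 < A) (hAB : A ≤ B) (b : ℝ) :
    ∃ g : Space → ℝ, IntegrableOn g (Metric.closedBall y s) ∧
      ∀ x ∈ Metric.closedBall y s \ {y}, ∀ α β : ℂ, A ≤ α.re → α.re ≤ B → ‖β‖ ≤ b →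
        ‖((‖x - y‖ / σ : ℝ) : ℂ) ^ α * H β x‖ ≤ g x := by
  obtain ⟨C, hC⟩ := hH.bound b
  refine ⟨fun x => C * ((σ ^ A)⁻¹ * ‖x - y‖ ^ (A + q) + (σ ^ B)⁻¹ * ‖x - y‖ ^ (B + q)), ?_, ?_⟩
  · exact ((integrableOn_rpow_closedBall y s (by linarith)).const_mul _ |>.add
      ((integrableOn_rpow_closedBall y s (by linarith)).const_mul _)).const_mul _
  · intro x hx α β h1 h2 h3
    have hr : 0 < ‖x - y‖ := norm_pos_iff.2 (sub_ne_zero.2 hx.2)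
    have hpos : 0 < ‖x - y‖ / σ := div_pos hr hσ
    rw [norm_mul, norm_cpow_ofReal hpos]
    refine (mul_le_mul (rpow_le_rpow_add_rpow hpos h1 h2) (hC β h3 x hx) (norm_nonneg _)
      (by positivity)).trans_eq ?_
    beta_reduce
    rw [Real.div_rpow hr.le hσ.le, Real.div_rpow hr.le hσ.le, Real.rpow_add hr, Real.rpow_add hr]
    ring

theorem IsEntireFamily.integrableOn (hH : IsEntireFamily y s q H) (hσ : 0 < σ) {α : ℂ} (β : ℂ)
    (hα : -q - 3 < α.re) :
    IntegrableOn (fun x => ((‖x - y‖ / σ : ℝ) : ℂ) ^ α * H β x) (Metric.closedBall y s) := by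
  obtain ⟨g, hg, hgb⟩ := hH.exists_dominating hσ hα le_rfl ‖β‖
  refine Integrable.mono' hg (hH.aestronglyMeasurable hσ α β) ?_
  filter_upwards [ae_mem_closedBall_diff y s] with x hx
  exact hgb x hx α β le_rfl le_rfl le_rfl

theorem IsEntireFamily.analyticAt (hH : IsEntireFamily y s q H) (hσ : 0 < σ) {p : ℂ × ℂ}
    (hp : -q - 3 < p.1.re) :
    AnalyticAt ℂ (fun p : ℂ × ℂ =>
      ∫ x in Metric.closedBall y s, ((‖x - y‖ / σ : ℝ) : ℂ) ^ p.1 * H p.2 x) p := by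
  obtain ⟨A, hA, hA'⟩ := exists_between hp
  obtain ⟨g, hg, hgb⟩ := hH.exists_dominating hσ hA (B := p.1.re + 1) (by linarith) (‖p.2‖ + 1)
  let V : Set (ℂ × ℂ) := {p' | A < p'.1.re ∧ p'.1.re < p.1.re + 1 ∧ ‖p'.2‖ < ‖p.2‖ + 1}
  have hre : Continuous fun p' : ℂ × ℂ => p'.1.re := by fun_prop
  have hV : IsOpen V := (isOpen_lt continuous_const hre).and
    ((isOpen_lt hre continuous_const).and (isOpen_lt continuous_snd.norm continuous_const))
  refine analyticAt_integral_of_dominated (hV.mem_nhds ⟨hA', lt_add_one _, lt_add_one _⟩)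
    (fun p' _ => hH.aestronglyMeasurable hσ p'.1 p'.2) ?_ hg ?_
  · filter_upwards [ae_mem_closedBall_diff y s] with x hx p' _
    have hpos : 0 < ‖x - y‖ / σ := div_pos (norm_pos_iff.2 (sub_ne_zero.2 hx.2)) hσ
    exact ((differentiable_const_cpow_ofReal hpos).comp differentiable_fst _).mul
      ((hH.differentiable x hx).comp differentiable_snd _)
  · filter_upwards [ae_mem_closedBall_diff y s] with x hx p' hp'
    exact hgb x hx _ _ hp'.1.le hp'.2.1.le hp'.2.2.le

end EntireFamily

theorem integrable_of_continuous_sphere {E : Type*} [NormedAddCommGroup E] {g : Space → E}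
    (hg : Continuous fun n : Metric.sphere (0 : Space) 1 => g n) :
    Integrable (fun n : Metric.sphere (0 : Space) 1 => g n) (volume : Measure Space).toSphere :=
  hg.integrable_of_hasCompactSupport (HasCompactSupport.of_compactSpace _)

/-- Integral over a ball of a function that is a finite sum of terms `r ^ e * c(n)` and a small
remainder. -/
theorem setIntegral_closedBall_of_expansion {y : Space} {s q σ : ℝ} (hσ : 0 < σ) (hs : 0 < s)
    {ι : Type*} {T : Finset ι} {e : ι → ℝ} {c : ι → ℂ → Space → ℂ} {Φ : ℂ → Space → ℂ}
    (hc : ∀ j ∈ T, ∀ β, Continuous fun n : Metric.sphere (0 : Space) 1 => c j β n)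
    (hH : IsEntireFamily y s q fun β x =>
      Φ β x - ∑ j ∈ T, ((‖x - y‖ ^ e j : ℝ) : ℂ) * c j β (dir y x)) {α : ℂ} (β : ℂ)
    (hα : -q - 3 < α.re) (he : ∀ j ∈ T, -(e j + 3) < α.re) :
    IntegrableOn (fun x => ((‖x - y‖ / σ : ℝ) : ℂ) ^ α * Φ β x) (Metric.closedBall y s) ∧
    ∫ x in Metric.closedBall y s, ((‖x - y‖ / σ : ℝ) : ℂ) ^ α * Φ β x =
      (∑ j ∈ T, radialIntegral σ s (e j) α *
        ∫ n : Metric.sphere (0 : Space) 1, c j β n ∂(volume : Measure Space).toSphere) +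
      ∫ x in Metric.closedBall y s, ((‖x - y‖ / σ : ℝ) : ℂ) ^ α *
        (Φ β x - ∑ j ∈ T, ((‖x - y‖ ^ e j : ℝ) : ℂ) * c j β (dir y x)) := by
  have h1 := fun j hj => setIntegral_closedBall_cpow y hσ hs (he j hj)
    (integrable_of_continuous_sphere (hc j hj β))
  have h2 := hH.integrableOn hσ β hα
  have h3 : IntegrableOn (fun x => ∑ j ∈ T, ((‖x - y‖ / σ : ℝ) : ℂ) ^ α *
      ((‖x - y‖ ^ e j : ℝ) : ℂ) * c j β (dir y x)) (Metric.closedBall y s) :=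
    integrable_finsetSum T fun j hj => (h1 j hj).1
  have hsplit : (fun x => ((‖x - y‖ / σ : ℝ) : ℂ) ^ α * Φ β x) = fun x =>
      (∑ j ∈ T, ((‖x - y‖ / σ : ℝ) : ℂ) ^ α * ((‖x - y‖ ^ e j : ℝ) : ℂ) * c j β (dir y x)) +
      ((‖x - y‖ / σ : ℝ) : ℂ) ^ α *
        (Φ β x - ∑ j ∈ T, ((‖x - y‖ ^ e j : ℝ) : ℂ) * c j β (dir y x)) := by
    ext1 x
    simp only [mul_assoc, ← Finset.mul_sum]
    ring
  rw [hsplit]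
  refine ⟨h3.add h2, ?_⟩
  rw [integral_add h3 h2, integral_finsetSum T fun j hj => (h1 j hj).1]
  congr 1
  exact Finset.sum_congr rfl fun j hj => (h1 j hj).2

/-! ### Pole and finite part of the radial integral -/

theorem analyticAt_radialIntegral {σ s e : ℝ} (hσ : 0 < σ) (hs : 0 < s) {α : ℂ}
    (hα : α ≠ ((-(e + 3) : ℝ) : ℂ)) : AnalyticAt ℂ (radialIntegral σ s e) α := by
  unfold radialIntegral
  refine AnalyticAt.div (AnalyticAt.mul ?_ analyticAt_const) (by fun_prop) ?_
  · exact (differentiable_const_cpow_ofReal (div_pos hs hσ)).analyticAt α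
  · intro h
    apply hα
    push_cast at h ⊢
    linear_combination h

/-- The regular part of `radialIntegral σ s e` at `0`. -/
def radialRegular (σ s e : ℝ) (α : ℂ) : ℂ :=
  if e = -3 then dslope (fun α : ℂ => ((s / σ : ℝ) : ℂ) ^ α) 0 α else radialIntegral σ s e α

/-- The pole `-(e + 3)` lies at the origin only for `e = -3`; the radial integral is then `(s / σ) ^
α / α`, and its regular part is the difference quotient of `α ↦ (s / σ) ^ α` at `0`. -/
theorem radialIntegral_eq (σ s e : ℝ) {α : ℂ} (hα : α ≠ 0) :
    radialIntegral σ s e α = (if e = -3 then 1 else 0) / α + radialRegular σ s e α := by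
  by_cases h : e = -3
  · rw [radialRegular, if_pos h, if_pos h, dslope_of_ne _ hα, slope_def_field, radialIntegral, h]
    norm_num
    field_simp
    ring
  · simp [radialRegular, h]

theorem analyticAt_radialRegular {σ s : ℝ} (hσ : 0 < σ) (hs : 0 < s) (e : ℝ) :
    AnalyticAt ℂ (radialRegular σ s e) 0 := by
  by_cases h : e = -3
  · have h1 : radialRegular σ s e = dslope (fun α : ℂ => ((s / σ : ℝ) : ℂ) ^ α) 0 := by
      ext1 α
      rw [radialRegular, if_pos h]
    rw [h1]
    have h2 : DifferentiableOn ℂ (dslope (fun α : ℂ => ((s / σ : ℝ) : ℂ) ^ α) 0) Set.univ :=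
      (Complex.differentiableOn_dslope univ_mem).2
        (differentiable_const_cpow_ofReal (div_pos hs hσ)).differentiableOn
    exact h2.analyticAt univ_mem
  · have h1 : radialRegular σ s e = radialIntegral σ s e := by
      ext1 α
      rw [radialRegular, if_neg h]
    rw [h1]
    refine analyticAt_radialIntegral hσ hs ?_
    intro h2
    apply h
    have : (0 : ℝ) = -(e + 3) := by exact_mod_cast h2
    linarith

/-- The finite part at `0` of `radialIntegral σ s e`. -/
def radialFinitePart (σ s e : ℝ) : ℝ :=
  if e = -3 then Real.log (s / σ) else s ^ (e + 3) / (e + 3)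

/-- For `e = -3` the value is the derivative of `(s / σ) ^ α` at `0`. This is the origin of the
logarithm in the partie finie and of its dependence on the length scale. -/
theorem radialRegular_zero {σ s : ℝ} (hσ : 0 < σ) (hs : 0 < s) (e : ℝ) :
    radialRegular σ s e 0 = (radialFinitePart σ s e : ℂ) := by
  by_cases h : e = -3
  · rw [radialRegular, if_pos h, radialFinitePart, if_pos h, dslope_same]
    have h0 : ((s / σ : ℝ) : ℂ) ≠ 0 := by exact_mod_cast (div_pos hs hσ).ne'
    have := ((hasDerivAt_id (0 : ℂ)).const_cpow (c := ((s / σ : ℝ) : ℂ)) (Or.inl h0)).deriv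
    simp only [id] at this
    rw [this, Complex.ofReal_log (div_pos hs hσ).le]
    simp
  · rw [radialRegular, if_neg h, radialFinitePart, if_neg h, radialIntegral]
    simp

/-! ### Singular expansions: continuity of coefficients and remainder bounds -/

/-- The remainder of a singular expansion after `m` terms. -/
def remainder (F : Space → ℝ) (y : Space) (a : ℕ → ℝ) (f : ℕ → Space → ℝ) (m : ℕ) (x : Space) : ℝ :=
  F x - ∑ i ∈ Finset.range m, ‖x - y‖ ^ a i * f i (dir y x)

section Expansion

variable {F : Space → ℝ} {y : Space} {a : ℕ → ℝ} {f : ℕ → Space → ℝ} {s : ℝ}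

theorem IsSingularExpansion.exists_remainder_le (h : IsSingularExpansion F y a f) (N : ℕ) :
    ∃ m : ℕ, (∀ i, i < m ↔ a i ≤ (N : ℝ)) ∧ ∀ ε > 0, ∃ η > 0, ∀ x, x ≠ y → ‖x - y‖ < η →
      |remainder F y a f m x| ≤ ε * ‖x - y‖ ^ N := by
  obtain ⟨m, hm, ho⟩ := h.2 N
  refine ⟨m, hm, fun ε hε => ?_⟩
  have h1 := ho.def hε
  rw [eventually_nhdsWithin_iff, Metric.eventually_nhds_iff] at h1
  obtain ⟨η, hη, h1⟩ := h1
  refine ⟨η, hη, fun x hx hxη => ?_⟩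
  have := h1 (by rwa [dist_eq_norm]) hx
  simpa [remainder, dir] using this

/-- The coefficients of a singular expansion of a function that is continuous near the singular
point are continuous on the unit sphere. -/
theorem IsSingularExpansion.continuous_coeff (h : IsSingularExpansion F y a f) (hs : 0 < s)
    (hF : ContinuousOn F (Metric.closedBall y s \ {y})) (i : ℕ) :
    Continuous fun n : Metric.sphere (0 : Space) 1 => f i n := by
  obtain ⟨m, hm, hR⟩ := h.exists_remainder_le ⌈a i⌉₊
  -- The order `⌈a i⌉₊` is high enough both to include the `i`-th term and to keep the remainder,
  -- divided by `r ^ a i`, small.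
  have hi : i < m := (hm i).2 (Nat.le_ceil _)
  have hN := Nat.le_ceil (a i)
  set N := ⌈a i⌉₊
  -- Halving the radius multiplies the `k`-th term by `v k`, and these factors are distinct.
  -- Sampling `F` along one direction at the radii `ρ / 2 ^ j` with the coefficients of a polynomial
  -- `p` thus multiplies the `k`-th term by `p (v k)`; the Lagrange basis polynomial isolates the
  -- `i`-th term. In this way `f i` becomes a uniform limit of continuous functions on the sphere.
  let v : ℕ → ℝ := fun k => (1 / 2 : ℝ) ^ a k
  have hv : Set.InjOn v (Finset.range m) := by
    intro k _ l _ hkl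
    refine h.1.injective ?_
    have h2 : StrictAnti fun t : ℝ => (1 / 2 : ℝ) ^ t :=
      Real.strictAnti_rpow_of_base_lt_one (by norm_num) (by norm_num)
    exact h2.injective hkl
  let p : Polynomial ℝ := Lagrange.basis (Finset.range m) v i
  have hp : ∀ k ∈ Finset.range m, p.eval (v k) = if k = i then 1 else 0 := by
    intro k hk
    by_cases hki : k = i
    · rw [if_pos hki, hki]
      exact Lagrange.eval_basis_self hv (Finset.mem_range.2 hi)
    · rw [if_neg hki]
      exact Lagrange.eval_basis_of_ne (Ne.symm hki) hk
  let T := Finset.range (p.natDegree + 1)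
  let K : ℝ := ∑ j ∈ T, |p.coeff j|
  have hK : 0 ≤ K := Finset.sum_nonneg fun j _ => abs_nonneg _
  have hnorm (n : Metric.sphere (0 : Space) 1) : ‖(n : Space)‖ = 1 := by simp
  refine continuous_of_uniform_approx_of_continuous fun u hu => ?_
  obtain ⟨ε, hε, hεu⟩ := Metric.mem_uniformity_dist.1 hu
  obtain ⟨η, hη, hR⟩ := hR (ε / (2 * (K + 1))) (by positivity)
  -- Below `η` the remainder estimate holds, below `1` the factor `ρ ^ (N - a i)` is at most `1`,
  -- and below `s` the sample points stay where `F` is continuous.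
  obtain ⟨ρ, hρ, hρ'⟩ := exists_between (show 0 < min (min η 1) s by positivity)
  have hρη : ρ < η := hρ'.trans_le ((min_le_left _ _).trans (min_le_left _ _))
  have hρ1 : ρ < 1 := hρ'.trans_le ((min_le_left _ _).trans (min_le_right _ _))
  have hρs : ρ < s := hρ'.trans_le (min_le_right _ _)
  let r : ℕ → ℝ := fun j => (1 / 2 : ℝ) ^ j * ρ
  have hr0 : ∀ j, 0 < r j := fun j => by positivity
  have hrρ : ∀ j, r j ≤ ρ := fun j =>
    mul_le_of_le_one_left hρ.le (pow_le_one₀ (by norm_num) (by norm_num))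
  have hsub : ∀ j (n : Metric.sphere (0 : Space) 1), ‖y + r j • (n : Space) - y‖ = r j := by
    intro j n
    rw [add_sub_cancel_left, norm_smul, hnorm, mul_one, Real.norm_of_nonneg (hr0 j).le]
  have hne : ∀ j (n : Metric.sphere (0 : Space) 1), y + r j • (n : Space) ≠ y := by
    intro j n hjn
    have := hsub j n
    rw [hjn, sub_self, norm_zero] at this
    exact (hr0 j).ne this
  have hdir : ∀ j (n : Metric.sphere (0 : Space) 1), dir y (y + r j • (n : Space)) = n := by
    intro j n
    rw [dir, hsub, add_sub_cancel_left, smul_smul, inv_mul_cancel₀ (hr0 j).ne', one_smul]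
  refine ⟨fun n => ρ ^ (-a i) * ∑ j ∈ T, p.coeff j * F (y + r j • (n : Space)), ?_, ?_⟩
  · refine continuous_const.mul (continuous_finsetSum _ fun j _ => continuous_const.mul ?_)
    refine hF.comp_continuous (by fun_prop) fun n => ⟨?_, hne j n⟩
    rw [mem_closedBall_iff_norm, hsub]
    exact (hrρ j).trans hρs.le
  · intro n
    apply hεu
    have hexp : ∑ j ∈ T, p.coeff j * F (y + r j • (n : Space)) = ρ ^ a i * f i n +
        ∑ j ∈ T, p.coeff j * remainder F y a f m (y + r j • (n : Space)) := by
      have h1 : ∀ j, F (y + r j • (n : Space)) = (∑ k ∈ Finset.range m,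
          v k ^ j * (ρ ^ a k * f k n)) + remainder F y a f m (y + r j • (n : Space)) := by
        intro j
        rw [remainder, hsub, hdir]
        have : ∀ k, v k ^ j * (ρ ^ a k * f k n) = r j ^ a k * f k n := by
          intro k
          rw [Real.mul_rpow (by positivity) hρ.le, ← Real.rpow_natCast, ← Real.rpow_natCast,
            ← Real.rpow_mul (by norm_num), ← Real.rpow_mul (by norm_num), mul_comm (a k)]
          ring
        simp only [this]
        ring
      simp only [h1, mul_add, Finset.sum_add_distrib]
      congr 1
      simp only [Finset.mul_sum]
      rw [Finset.sum_comm]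
      have h2 : ∀ k ∈ Finset.range m, ∑ j ∈ T, p.coeff j * (v k ^ j * (ρ ^ a k * f k n)) =
          if k = i then ρ ^ a k * f k n else 0 := by
        intro k hk
        have h3 := hp k hk
        rw [Polynomial.eval_eq_sum_range] at h3
        simp only [← mul_assoc, ← Finset.sum_mul]
        rw [h3]
        by_cases hki : k = i <;> simp [hki]
      rw [Finset.sum_congr rfl h2, Finset.sum_ite_eq' _ _ _, if_pos (Finset.mem_range.2 hi)]
    have hρa : ρ ^ (-a i) * ρ ^ a i = 1 := by
      rw [← Real.rpow_add hρ]
      simp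
    beta_reduce
    rw [hexp, Real.dist_eq, mul_add, ← mul_assoc, hρa, one_mul, sub_add_cancel_left, abs_neg,
      abs_mul, abs_of_pos (Real.rpow_pos_of_pos hρ _)]
    have hsum : |∑ j ∈ T, p.coeff j * remainder F y a f m (y + r j • (n : Space))| ≤
        K * (ε / (2 * (K + 1)) * ρ ^ N) := by
      refine (Finset.abs_sum_le_sum_abs _ _).trans ?_
      rw [Finset.sum_mul]
      refine Finset.sum_le_sum fun j _ => ?_
      rw [abs_mul]
      refine mul_le_mul_of_nonneg_left ?_ (abs_nonneg _)
      refine (hR _ (hne j n) ?_).trans ?_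
      · rw [hsub]
        exact (hrρ j).trans_lt hρη
      · rw [hsub]
        gcongr
        exact hrρ j
    have hpow : ρ ^ (-a i) * ρ ^ N ≤ 1 := by
      rw [← Real.rpow_natCast, ← Real.rpow_add hρ]
      exact Real.rpow_le_one hρ.le hρ1.le (by linarith)
    have hKε : K * (ε / (2 * (K + 1))) < ε := by
      rw [← mul_div_assoc, div_lt_iff₀ (by positivity)]
      nlinarith
    calc ρ ^ (-a i) * |∑ j ∈ T, p.coeff j * remainder F y a f m (y + r j • (n : Space))|
        ≤ ρ ^ (-a i) * (K * (ε / (2 * (K + 1)) * ρ ^ N)) := by gcongr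
      _ = K * (ε / (2 * (K + 1))) * (ρ ^ (-a i) * ρ ^ N) := by ring
      _ ≤ K * (ε / (2 * (K + 1))) * 1 := by gcongr
      _ < ε := by rwa [mul_one]

theorem continuousOn_remainder (hF : ContinuousOn F (Metric.closedBall y s \ {y}))
    (hf : ∀ i, Continuous fun n : Metric.sphere (0 : Space) 1 => f i n) (m : ℕ) :
    ContinuousOn (remainder F y a f m) (Metric.closedBall y s \ {y}) := by
  unfold remainder
  refine hF.sub (continuousOn_finsetSum _ fun i _ => ContinuousOn.mul ?_ ?_)
  · intro x hx
    refine ContinuousAt.continuousWithinAt ?_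
    exact ContinuousAt.rpow_const (by fun_prop)
      (Or.inl (norm_ne_zero_iff.2 (sub_ne_zero.2 hx.2)))
  · exact (continuousOn_comp_dir y (hf i)).mono fun x hx => hx.2

/-- Near `y` the asymptotic estimate gives the bound; on the rest of the ball, which is compact and
avoids `y`, the remainder is bounded because the coefficients are continuous, and `‖x - y‖` is
bounded below. -/
theorem IsSingularExpansion.exists_remainder_bound (h : IsSingularExpansion F y a f) (hs : 0 < s)
    (hF : ContinuousOn F (Metric.closedBall y s \ {y})) (N : ℕ) :
    ∃ m : ℕ, (∀ i, i < m ↔ a i ≤ (N : ℝ)) ∧ ∃ C : ℝ, ∀ x ∈ Metric.closedBall y s \ {y},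
      |remainder F y a f m x| ≤ C * ‖x - y‖ ^ N := by
  obtain ⟨m, hm, hR⟩ := h.exists_remainder_le N
  refine ⟨m, hm, ?_⟩
  obtain ⟨η, hη, hR⟩ := hR 1 one_pos
  have hcompact : IsCompact (Metric.closedBall y s \ Metric.ball y η) :=
    (isCompact_closedBall y s).diff Metric.isOpen_ball
  have hsub : Metric.closedBall y s \ Metric.ball y η ⊆ Metric.closedBall y s \ {y} :=
    fun x hx => ⟨hx.1, fun hxy => hx.2 (by rw [hxy]; exact Metric.mem_ball_self hη)⟩
  obtain ⟨C, hC⟩ := hcompact.exists_bound_of_continuousOn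
    ((continuousOn_remainder hF (h.continuous_coeff hs hF) m).mono hsub)
  refine ⟨max 1 (C / η ^ N), fun x hx => ?_⟩
  by_cases hxη : ‖x - y‖ < η
  · refine (hR x hx.2 hxη).trans ?_
    gcongr
    exact le_max_left _ _
  · have h1 := hC x ⟨hx.1, by rwa [mem_ball_iff_norm]⟩
    rw [Real.norm_eq_abs] at h1
    have hCpos : 0 ≤ C := (abs_nonneg _).trans h1
    calc |remainder F y a f m x| ≤ C := h1
      _ = C / η ^ N * η ^ N := by field_simp
      _ ≤ C / η ^ N * ‖x - y‖ ^ N := by gcongr; exact not_lt.1 hxη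
      _ ≤ _ := by gcongr; exact le_max_right _ _

end Expansion

/-! ### Taylor expansion of the power of the distance to the other point -/

/-- `|x - y₂|² / |y₁ - y₂|²` for `x = y₁ + t |y₁ - y₂| n`, as a polynomial in a complex `t`. -/
def distSq (y₁ y₂ : Space) (t : ℂ) (n : Space) : ℂ :=
  1 + 2 * t * ((inner ℝ n (y₁ - y₂) / ‖y₁ - y₂‖ : ℝ) : ℂ) + t ^ 2

/-- `log (|x - y₂| / σ)` for `x = y₁ + t |y₁ - y₂| n`, continued to complex `t`. -/
def logDist (y₁ y₂ : Space) (σ : ℝ) (t : ℂ) (n : Space) : ℂ :=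
  (Real.log (‖y₁ - y₂‖ / σ) : ℂ) + Complex.log (distSq y₁ y₂ t n) / 2

/-- The coefficient of `r₁ ^ k` in the expansion of `(r₂ / σ) ^ β` at `y₁`. -/
def distCoeff (y₁ y₂ : Space) (σ : ℝ) (k : ℕ) (β : ℂ) (n : Space) : ℂ :=
  cauchyPowerSeries (fun t => Complex.exp (β * logDist y₁ y₂ σ t n)) 0 (1 / 2) k
    (fun _ => ((‖y₁ - y₂‖⁻¹ : ℝ) : ℂ))

section

variable {y₁ y₂ : Space} {σ : ℝ}

/-- With `u = |Re t|` and `|t| ≤ 1/2` the real part is at least `3/4 - 2u + 2u² = 2(u - 1/2)² +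
1/4`. So the principal logarithm is holomorphic along the whole disc, and the radius `1/2` matches
balls of radius below half the distance of the two points. -/
theorem distSq_re_pos {t : ℂ} (ht : ‖t‖ ≤ 1 / 2) {n : Space} (hn : ‖n‖ = 1) :
    0 < (distSq y₁ y₂ t n).re := by
  set c : ℝ := inner ℝ n (y₁ - y₂) / ‖y₁ - y₂‖ with hc
  have hc1 : |c| ≤ 1 := by
    rw [hc, abs_div, abs_norm]
    refine div_le_one_of_le₀ ?_ (norm_nonneg _)
    simpa [hn] using abs_real_inner_le_norm n (y₁ - y₂)
  have hre : (distSq y₁ y₂ t n).re = 1 + 2 * t.re * c + (t.re ^ 2 - t.im ^ 2) := by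
    rw [distSq, ← hc]
    simp [pow_two]
  have hsq : t.re ^ 2 + t.im ^ 2 ≤ 1 / 4 := by
    have h1 := Complex.sq_norm t
    rw [Complex.normSq_apply] at h1
    nlinarith [norm_nonneg t]
  have h2 : -|t.re| ≤ t.re * c := by
    have h3 : |t.re * c| ≤ |t.re| := by
      rw [abs_mul]
      exact mul_le_of_le_one_right (abs_nonneg _) hc1
    linarith [neg_abs_le (t.re * c)]
  rw [hre]
  nlinarith [sq_abs t.re, sq_nonneg (|t.re| - 1 / 2)]

theorem continuousOn_logDist : ContinuousOn (fun p : ℂ × Space => logDist y₁ y₂ σ p.1 p.2)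
    (Metric.closedBall 0 (1 / 2) ×ˢ Metric.sphere 0 1) := by
  unfold logDist
  refine continuousOn_const.add (ContinuousOn.div_const (ContinuousOn.clog ?_ ?_) _)
  · unfold distSq
    fun_prop
  · intro p hp
    exact Or.inl (distSq_re_pos (by simpa using hp.1) (by simpa using hp.2))

theorem exists_norm_logDist_le (y₁ y₂ : Space) (σ : ℝ) :
    ∃ K : ℝ, ∀ t ∈ Metric.closedBall (0 : ℂ) (1 / 2), ∀ n ∈ Metric.sphere (0 : Space) 1,
      ‖logDist y₁ y₂ σ t n‖ ≤ K := by
  obtain ⟨K, hK⟩ := ((isCompact_closedBall (0 : ℂ) (1 / 2)).prod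
    (isCompact_sphere (0 : Space) 1)).exists_bound_of_continuousOn
    (continuousOn_logDist (y₁ := y₁) (y₂ := y₂) (σ := σ))
  exact ⟨K, fun t ht n hn => hK (t, n) ⟨ht, hn⟩⟩

theorem diffContOnCl_exp_logDist (β : ℂ) {n : Space} (hn : n ∈ Metric.sphere (0 : Space) 1) :
    DiffContOnCl ℂ (fun t => Complex.exp (β * logDist y₁ y₂ σ t n)) (Metric.ball 0 (1 / 2)) := by
  refine DifferentiableOn.diffContOnCl_ball (U := Metric.closedBall 0 (1 / 2)) ?_ le_rfl
  intro t ht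
  refine DifferentiableAt.differentiableWithinAt ?_
  unfold logDist
  have h1 : DifferentiableAt ℂ (fun t => distSq y₁ y₂ t n) t := by
    unfold distSq
    fun_prop
  have h2 : distSq y₁ y₂ t n ∈ Complex.slitPlane :=
    Or.inl (distSq_re_pos (by simpa using ht) (by simpa using hn))
  exact ((((h1.clog h2).div_const 2).const_add _).const_mul β).cexp

theorem norm_exp_mul_le {K b : ℝ} {β v : ℂ} (hβ : ‖β‖ ≤ b) (hv : ‖v‖ ≤ K) :
    ‖Complex.exp (β * v)‖ ≤ Real.exp (b * K) := by
  rw [Complex.norm_exp, Real.exp_le_exp]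
  refine (Complex.re_le_norm _).trans ?_
  rw [norm_mul]
  exact mul_le_mul hβ hv (norm_nonneg _) ((norm_nonneg _).trans hβ)

theorem distCoeff_eq_integral (k : ℕ) (β : ℂ) (n : Space) :
    distCoeff y₁ y₂ σ k β n = (2 * Real.pi * Complex.I : ℂ)⁻¹ * ∫ θ in (0 : ℝ)..2 * Real.pi,
      deriv (circleMap 0 (1 / 2)) θ * ((((‖y₁ - y₂‖⁻¹ : ℝ) : ℂ) / circleMap 0 (1 / 2) θ) ^ k *
        ((circleMap 0 (1 / 2) θ)⁻¹ *
          Complex.exp (β * logDist y₁ y₂ σ (circleMap 0 (1 / 2) θ) n))) := by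
  rw [distCoeff, cauchyPowerSeries_apply, circleIntegral]
  simp only [smul_eq_mul, sub_zero]

theorem continuous_distCoeff (k : ℕ) (β : ℂ) :
    Continuous fun n : Metric.sphere (0 : Space) 1 => distCoeff y₁ y₂ σ k β n := by
  simp only [distCoeff_eq_integral]
  refine continuous_const.mul ?_
  refine intervalIntegral.continuous_parametric_intervalIntegral_of_continuous'
    (f := fun (n : Metric.sphere (0 : Space) 1) (θ : ℝ) => deriv (circleMap 0 (1 / 2)) θ *
      ((((‖y₁ - y₂‖⁻¹ : ℝ) : ℂ) / circleMap 0 (1 / 2) θ) ^ k *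
        ((circleMap 0 (1 / 2) θ)⁻¹ *
          Complex.exp (β * logDist y₁ y₂ σ (circleMap 0 (1 / 2) θ) n)))) ?_ _ _
  have hne : ∀ θ : ℝ, circleMap 0 (1 / 2) θ ≠ 0 := fun θ => circleMap_ne_center (by norm_num)
  have h1 : Continuous fun p : Metric.sphere (0 : Space) 1 × ℝ =>
      logDist y₁ y₂ σ (circleMap 0 (1 / 2) p.2) p.1 :=
    continuousOn_logDist.comp_continuous (f := fun p : Metric.sphere (0 : Space) 1 × ℝ =>
      (circleMap 0 (1 / 2) p.2, (p.1 : Space))) (by fun_prop)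
      fun p => ⟨circleMap_mem_closedBall 0 (by norm_num) _, p.1.2⟩
  have h2 : Continuous fun p : Metric.sphere (0 : Space) 1 × ℝ => (circleMap 0 (1 / 2) p.2)⁻¹ :=
    Continuous.inv₀ (by fun_prop) fun p => hne _
  simp only [Function.uncurry_def, deriv_circleMap, div_eq_mul_inv] at *
  fun_prop

theorem differentiable_distCoeff (k : ℕ) {n : Space} (hn : n ∈ Metric.sphere (0 : Space) 1) :
    Differentiable ℂ fun β => distCoeff y₁ y₂ σ k β n := by
  intro β₀
  simp only [distCoeff_eq_integral, intervalIntegral.integral_of_le Real.two_pi_pos.le]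
  refine DifferentiableAt.const_mul ?_ _
  obtain ⟨K, hK⟩ := exists_norm_logDist_le y₁ y₂ σ
  have hmem : ∀ θ : ℝ, circleMap 0 (1 / 2) θ ∈ Metric.closedBall (0 : ℂ) (1 / 2) := fun θ =>
    circleMap_mem_closedBall 0 (by norm_num) θ
  have hne : ∀ θ : ℝ, circleMap 0 (1 / 2) θ ≠ 0 := fun θ => circleMap_ne_center (by norm_num)
  have h1 : Continuous fun θ : ℝ => logDist y₁ y₂ σ (circleMap 0 (1 / 2) θ) n :=
    continuousOn_logDist.comp_continuous (f := fun θ : ℝ => (circleMap 0 (1 / 2) θ, n))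
      (by fun_prop) fun θ => ⟨hmem θ, hn⟩
  have h2 : Continuous fun θ : ℝ => (circleMap 0 (1 / 2) θ)⁻¹ :=
    Continuous.inv₀ (by fun_prop) hne
  refine differentiableAt_integral_of_dominated (V := Metric.closedBall β₀ 1)
    (g := fun θ => ‖deriv (circleMap 0 (1 / 2)) θ‖ *
      (‖(((‖y₁ - y₂‖⁻¹ : ℝ) : ℂ) * (circleMap 0 (1 / 2) θ)⁻¹) ^ k‖ *
        (‖(circleMap 0 (1 / 2) θ)⁻¹‖ * Real.exp ((‖β₀‖ + 1) * K))))
    (Metric.closedBall_mem_nhds _ one_pos) ?_ ?_ ?_ ?_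
  · intro β _
    refine Continuous.aestronglyMeasurable ?_
    simp only [deriv_circleMap, div_eq_mul_inv]
    fun_prop
  · refine Eventually.of_forall fun θ β _ => ?_
    fun_prop
  · rw [← IntegrableOn, ← intervalIntegrable_iff_integrableOn_Ioc_of_le Real.two_pi_pos.le]
    refine Continuous.intervalIntegrable ?_ _ _
    simp only [deriv_circleMap]
    fun_prop
  · refine Eventually.of_forall fun θ β hβ => ?_
    rw [norm_mul, norm_mul, norm_mul, ← div_eq_mul_inv ((‖y₁ - y₂‖⁻¹ : ℝ) : ℂ)]
    gcongr
    refine norm_exp_mul_le ?_ (hK _ (hmem θ) n hn)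
    have h3 := norm_le_norm_add_norm_sub' β β₀
    rw [mem_closedBall_iff_norm] at hβ
    linarith

/-- Cauchy's estimate on `|t| = 1/2`, uniform over directions and bounded `β`. The free argument `w`
is needed twice: `w = ‖y₁ - y₂‖⁻¹` bounds the coefficients, and `w = t` the Taylor terms at `t`. -/
theorem norm_distCoeff_le {K b : ℝ} (hK : ∀ t ∈ Metric.closedBall (0 : ℂ) (1 / 2),
    ∀ n ∈ Metric.sphere (0 : Space) 1, ‖logDist y₁ y₂ σ t n‖ ≤ K) (k : ℕ) {β : ℂ} (hβ : ‖β‖ ≤ b)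
    {n : Space} (hn : n ∈ Metric.sphere (0 : Space) 1) (w : ℂ) :
    ‖cauchyPowerSeries (fun t => Complex.exp (β * logDist y₁ y₂ σ t n)) 0 (1 / 2) k
      (fun _ => w)‖ ≤ Real.exp (b * K) * (2 * ‖w‖) ^ k := by
  refine (ContinuousMultilinearMap.le_opNorm (𝕜 := ℂ) (cauchyPowerSeries
    (fun t => Complex.exp (β * logDist y₁ y₂ σ t n)) 0 (1 / 2) k) _).trans ?_
  have h1 := norm_cauchyPowerSeries_le
    (fun t => Complex.exp (β * logDist y₁ y₂ σ t n)) 0 (1 / 2) k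
  have h2 : (∫ θ in (0 : ℝ)..2 * Real.pi,
      ‖Complex.exp (β * logDist y₁ y₂ σ (circleMap 0 (1 / 2) θ) n)‖) ≤
      Real.exp (b * K) * (2 * Real.pi) := by
    have := intervalIntegral.norm_integral_le_of_norm_le_const (a := 0) (b := 2 * Real.pi)
      (f := fun θ => ‖Complex.exp (β * logDist y₁ y₂ σ (circleMap 0 (1 / 2) θ) n)‖)
      (C := Real.exp (b * K)) (fun θ _ => by
        rw [norm_norm]
        exact norm_exp_mul_le hβ (hK _ (circleMap_mem_closedBall 0 (by norm_num) _) n hn))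
    rw [sub_zero, abs_of_pos Real.two_pi_pos] at this
    exact (Real.le_norm_self _).trans this
  have h3 : ‖cauchyPowerSeries (fun t => Complex.exp (β * logDist y₁ y₂ σ t n)) 0 (1 / 2) k‖ ≤
      Real.exp (b * K) * 2 ^ k := by
    refine h1.trans ?_
    rw [abs_of_pos (by norm_num : (0 : ℝ) < 1 / 2), one_div, inv_inv]
    gcongr
    rw [inv_mul_le_iff₀ Real.two_pi_pos]
    linarith
  calc _ ≤ Real.exp (b * K) * 2 ^ k * ‖w‖ ^ k := by
        simp only [Finset.prod_const, Finset.card_univ, Fintype.card_fin]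
        gcongr
    _ = _ := by rw [mul_pow]; ring

/-- By Cauchy's estimate the Taylor series is dominated by a geometric series of ratio `2 * r / ‖y₁
- y₂‖ < 1`; the bound is the tail of the latter. -/
theorem norm_exp_logDist_sub_le {K b : ℝ} (hK : ∀ t ∈ Metric.closedBall (0 : ℂ) (1 / 2),
    ∀ n ∈ Metric.sphere (0 : Space) 1, ‖logDist y₁ y₂ σ t n‖ ≤ K) (M : ℕ) {β : ℂ} (hβ : ‖β‖ ≤ b)
    {n : Space} (hn : n ∈ Metric.sphere (0 : Space) 1) {r : ℝ} (hr : 0 ≤ r)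
    (hr' : r * ‖y₁ - y₂‖⁻¹ < 1 / 2) :
    ‖Complex.exp (β * logDist y₁ y₂ σ ((r * ‖y₁ - y₂‖⁻¹ : ℝ) : ℂ) n) -
      ∑ k ∈ Finset.range M, (r : ℂ) ^ k * distCoeff y₁ y₂ σ k β n‖ ≤
      Real.exp (b * K) * (2 * (r * ‖y₁ - y₂‖⁻¹)) ^ M / (1 - 2 * (r * ‖y₁ - y₂‖⁻¹)) := by
  set t : ℝ := r * ‖y₁ - y₂‖⁻¹
  have ht0 : 0 ≤ t := by positivity
  have hd := diffContOnCl_exp_logDist (y₁ := y₁) (y₂ := y₂) (σ := σ) β hn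
  have hci : CircleIntegrable (fun t => Complex.exp (β * logDist y₁ y₂ σ t n)) 0 (1 / 2) :=
    (hd.continuousOn_ball.mono Metric.sphere_subset_closedBall).circleIntegrable (by norm_num)
  have htn : ‖(t : ℂ)‖ < 1 / 2 := by rwa [Complex.norm_real, Real.norm_of_nonneg ht0]
  have h1 := hasSum_cauchyPowerSeries_integral hci htn
  rw [zero_add, hd.two_pi_i_inv_smul_circleIntegral_sub_inv_smul (by simpa using htn)] at h1
  have h2 := norm_sub_le_of_geometric_bound_of_hasSum (r := 2 * t) (by linarith)
    (fun k => by
      have := norm_distCoeff_le hK k hβ hn (t : ℂ)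
      rw [Complex.norm_real, Real.norm_of_nonneg ht0] at this
      exact this) h1 M
  have hk : ∀ k, (r : ℂ) ^ k * distCoeff y₁ y₂ σ k β n = cauchyPowerSeries
      (fun t => Complex.exp (β * logDist y₁ y₂ σ t n)) 0 (1 / 2) k (fun _ => (t : ℂ)) := by
    intro k
    rw [distCoeff, FormalMultilinearSeries.apply_eq_pow_smul_coeff,
      FormalMultilinearSeries.apply_eq_pow_smul_coeff, smul_eq_mul, smul_eq_mul, ← mul_assoc,
      ← mul_pow, ← Complex.ofReal_mul]
  rw [norm_sub_rev]
  simp only [hk]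
  exact h2

/-- For `β = 0` the expanded function is the constant `1`, so the expansion of the product collapses
to that of `F`. -/
theorem distCoeff_zero (k : ℕ) (n : Space) :
    distCoeff y₁ y₂ σ k 0 n = if k = 0 then 1 else 0 := by
  have h1 : DiffContOnCl ℂ (fun _ : ℂ => (1 : ℂ)) (Metric.ball 0 ((1 / 2 : NNReal) : ℝ)) :=
    diffContOnCl_const
  have h2 := (h1.hasFPowerSeriesOnBall (by norm_num)).hasFPowerSeriesAt.eq_formalMultilinearSeries
    (hasFPowerSeriesAt_const (c := (1 : ℂ)) (e := (0 : ℂ)))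
  have h3 : ((1 / 2 : NNReal) : ℝ) = 1 / 2 := by norm_num
  rw [h3] at h2
  simp only [distCoeff, zero_mul, Complex.exp_zero]
  rw [h2]
  rcases k with _ | k
  · simp [constFormalMultilinearSeries_apply_zero]
  · simp [constFormalMultilinearSeries_apply_succ]

/-- By the law of cosines `distSq` at real `t` is a squared ratio of distances, whose logarithm is
real. -/
theorem exp_logDist (hy : y₁ ≠ y₂) (hσ : 0 < σ) {x : Space} (hx₁ : x ≠ y₁) (hx₂ : x ≠ y₂) (β : ℂ) :
    Complex.exp (β * logDist y₁ y₂ σ ((‖x - y₁‖ * ‖y₁ - y₂‖⁻¹ : ℝ) : ℂ) (dir y₁ x)) =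
      ((‖x - y₂‖ / σ : ℝ) : ℂ) ^ β := by
  have hρ : 0 < ‖y₁ - y₂‖ := norm_pos_iff.2 (sub_ne_zero.2 hy)
  have hr₁ : 0 < ‖x - y₁‖ := norm_pos_iff.2 (sub_ne_zero.2 hx₁)
  have hr₂ : 0 < ‖x - y₂‖ := norm_pos_iff.2 (sub_ne_zero.2 hx₂)
  have h1 : distSq y₁ y₂ ((‖x - y₁‖ * ‖y₁ - y₂‖⁻¹ : ℝ) : ℂ) (dir y₁ x) =
      (((‖x - y₂‖ / ‖y₁ - y₂‖) ^ 2 : ℝ) : ℂ) := by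
    have h2 : ‖x - y₂‖ ^ 2 = ‖x - y₁‖ ^ 2 + 2 * inner ℝ (x - y₁) (y₁ - y₂) + ‖y₁ - y₂‖ ^ 2 := by
      rw [← norm_add_sq_real, sub_add_sub_cancel]
    have h3 : (‖x - y₂‖ / ‖y₁ - y₂‖) ^ 2 = 1 + 2 * (‖x - y₁‖ * ‖y₁ - y₂‖⁻¹) *
        (inner ℝ (dir y₁ x) (y₁ - y₂) / ‖y₁ - y₂‖) + (‖x - y₁‖ * ‖y₁ - y₂‖⁻¹) ^ 2 := by
      rw [div_pow, h2, dir, real_inner_smul_left]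
      field_simp
      ring
    rw [h3, distSq]
    push_cast
    ring
  rw [logDist, h1, ← Complex.ofReal_log (by positivity), Complex.cpow_def_of_ne_zero
    (by exact_mod_cast (div_pos hr₂ hσ).ne'), ← Complex.ofReal_log (by positivity), mul_comm β]
  congr 2
  rw [Real.log_pow, Real.log_div hρ.ne' hσ.ne', Real.log_div hr₂.ne' hρ.ne',
    Real.log_div hr₂.ne' hσ.ne']
  push_cast
  ring

end

/-! ### Expansion of the product of the power and the function -/

theorem rpow_le_mul_rpow {r s p q : ℝ} (hr : 0 < r) (hrs : r ≤ s) (hqp : q ≤ p) :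
    r ^ p ≤ s ^ (p - q) * r ^ q := by
  have h1 : r ^ p = r ^ (p - q) * r ^ q := by rw [← Real.rpow_add hr, sub_add_cancel]
  rw [h1]
  gcongr

theorem ne_of_mem_closedBall {y₁ y₂ : Space} {s : ℝ} (hs' : s < ‖y₁ - y₂‖ / 2) {x : Space}
    (hx : x ∈ Metric.closedBall y₁ s) : x ≠ y₂ := by
  rintro rfl
  rw [mem_closedBall_iff_norm, norm_sub_rev] at hx
  linarith [norm_nonneg (y₁ - x)]

/-- The exponents in the expansion of `(r₂ / σ) ^ β * F` at `y₁`. -/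
def productExponent (a : ℕ → ℝ) (j : ℕ × ℕ) : ℝ := a j.1 + j.2

/-- The coefficients in the expansion of `(r₂ / σ) ^ β * F` at `y₁`. -/
def productCoeff (y₁ y₂ : Space) (σ : ℝ) (f : ℕ → Space → ℝ) (j : ℕ × ℕ) (β : ℂ) (n : Space) : ℂ :=
  (f j.1 n : ℂ) * distCoeff y₁ y₂ σ j.2 β n

/-- The remainder in the expansion of `(r₂ / σ) ^ β * F` at `y₁`. -/
def productRemainder (y₁ y₂ : Space) (σ : ℝ) (F : Space → ℝ) (a : ℕ → ℝ) (f : ℕ → Space → ℝ)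
    (m M : ℕ) (β : ℂ) (x : Space) : ℂ :=
  ((‖x - y₂‖ / σ : ℝ) : ℂ) ^ β * (F x : ℂ) - ∑ j ∈ Finset.range m ×ˢ Finset.range M,
    ((‖x - y₁‖ ^ productExponent a j : ℝ) : ℂ) * productCoeff y₁ y₂ σ f j β (dir y₁ x)

section

variable {y₁ y₂ : Space} {σ s : ℝ} {F : Space → ℝ} {a : ℕ → ℝ} {f : ℕ → Space → ℝ}

/-- Substituting the two expansions one after the other leaves two errors: the full power times the
remainder of `F`, and the Taylor tail of the power times the explicit terms of `F`. Each can be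
estimated separately. -/
theorem productRemainder_eq {x : Space} (hx : x ≠ y₁) (m M : ℕ) (β : ℂ) :
    productRemainder y₁ y₂ σ F a f m M β x =
      ((‖x - y₂‖ / σ : ℝ) : ℂ) ^ β * (remainder F y₁ a f m x : ℂ) +
      ∑ i ∈ Finset.range m, (((‖x - y₂‖ / σ : ℝ) : ℂ) ^ β - ∑ k ∈ Finset.range M,
        (‖x - y₁‖ : ℂ) ^ k * distCoeff y₁ y₂ σ k β (dir y₁ x)) *
          ((‖x - y₁‖ ^ a i : ℝ) * f i (dir y₁ x) : ℂ) := by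
  have hr : 0 < ‖x - y₁‖ := norm_pos_iff.2 (sub_ne_zero.2 hx)
  have h1 : ∀ i k : ℕ, ((‖x - y₁‖ ^ productExponent a (i, k) : ℝ) : ℂ) *
      productCoeff y₁ y₂ σ f (i, k) β (dir y₁ x) = (‖x - y₁‖ : ℂ) ^ k *
        distCoeff y₁ y₂ σ k β (dir y₁ x) * ((‖x - y₁‖ ^ a i : ℝ) * f i (dir y₁ x) : ℂ) := by
    intro i k
    rw [productExponent, productCoeff, Real.rpow_add hr, Real.rpow_natCast]
    push_cast
    ring
  rw [productRemainder, Finset.sum_product]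
  simp only [h1, sub_mul, Finset.sum_sub_distrib, ← Finset.sum_mul, ← Finset.mul_sum]
  rw [remainder]
  push_cast
  ring

/-- Of the two errors the first is `O(r ^ N)` by hypothesis and the second is a sum of `O(r ^ (M + a
i))`; since `a 0` is the lowest exponent, `M ≥ N - a 0` Taylor terms suffice. -/
theorem isEntireFamily_productRemainder (hy : y₁ ≠ y₂) (hσ : 0 < σ)
    (hs' : s < ‖y₁ - y₂‖ / 2) (hF : ContinuousOn F (Metric.closedBall y₁ s \ {y₁}))
    (hf : ∀ i, Continuous fun n : Metric.sphere (0 : Space) 1 => f i n) (ha : StrictMono a)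
    {N m M : ℕ} (hR : ∃ C : ℝ, ∀ x ∈ Metric.closedBall y₁ s \ {y₁},
      |remainder F y₁ a f m x| ≤ C * ‖x - y₁‖ ^ N) (hM : (N : ℝ) ≤ M + a 0) :
    IsEntireFamily y₁ s N (productRemainder y₁ y₂ σ F a f m M) := by
  have hρ : 0 < ‖y₁ - y₂‖ := norm_pos_iff.2 (sub_ne_zero.2 hy)
  have hpos : ∀ x ∈ Metric.closedBall y₁ s \ {y₁}, 0 < ‖x - y₂‖ / σ := fun x hx =>
    div_pos (norm_pos_iff.2 (sub_ne_zero.2 (ne_of_mem_closedBall hs' hx.1))) hσ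
  have hn : ∀ x ∈ Metric.closedBall y₁ s \ {y₁}, dir y₁ x ∈ Metric.sphere (0 : Space) 1 :=
    fun x hx => dir_mem_sphere hx.2
  refine ⟨fun β => ?_, fun x hx => ?_, fun b => ?_⟩
  · refine ContinuousOn.sub (ContinuousOn.mul ?_ ?_)
      (continuousOn_finsetSum _ fun j _ => ContinuousOn.mul ?_ ?_)
    · intro x hx
      refine ContinuousAt.continuousWithinAt ?_
      have h1 : ContinuousAt (fun z : ℂ => z ^ β) ((‖x - y₂‖ / σ : ℝ) : ℂ) :=
        continuousAt_cpow_const (Or.inl (by simpa using hpos x hx))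
      exact h1.comp (f := fun x : Space => ((‖x - y₂‖ / σ : ℝ) : ℂ)) (by fun_prop)
    · exact Complex.continuous_ofReal.comp_continuousOn hF
    · refine Complex.continuous_ofReal.comp_continuousOn fun x hx => ?_
      exact (ContinuousAt.rpow_const (f := fun x : Space => ‖x - y₁‖) (by fun_prop)
        (Or.inl (norm_ne_zero_iff.2 (sub_ne_zero.2 hx.2)))).continuousWithinAt
    · refine (continuousOn_comp_dir (g := productCoeff y₁ y₂ σ f j β) y₁ ?_).mono fun x hx => hx.2
      exact (Complex.continuous_ofReal.comp (hf _)).mul (continuous_distCoeff _ _)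
  · unfold productRemainder productCoeff
    have h1 := differentiable_const_cpow_ofReal (hpos x hx)
    have h2 : ∀ k, Differentiable ℂ fun β => distCoeff y₁ y₂ σ k β (dir y₁ x) := fun k =>
      differentiable_distCoeff k (hn x hx)
    fun_prop
  · obtain ⟨C, hC⟩ := hR
    obtain ⟨K, hK⟩ := exists_norm_logDist_le y₁ y₂ σ
    have hfb : ∀ i, ∃ B : ℝ, 0 ≤ B ∧ ∀ n ∈ Metric.sphere (0 : Space) 1, |f i n| ≤ B := by
      intro i
      obtain ⟨B, hB⟩ := (isCompact_sphere (0 : Space) 1).exists_bound_of_continuousOn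
        (continuousOn_iff_continuous_domRestrict.2 (hf i))
      exact ⟨max B 0, le_max_right _ _, fun n hn => (hB n hn).trans (le_max_left _ _)⟩
    choose B hB0 hB using hfb
    have hst : s * ‖y₁ - y₂‖⁻¹ < 1 / 2 := by
      rw [← div_eq_mul_inv, div_lt_iff₀ hρ]
      linarith
    set τ : ℝ := s * ‖y₁ - y₂‖⁻¹
    let L : ℝ := Real.exp (b * K) * (2 * ‖y₁ - y₂‖⁻¹) ^ M / (1 - 2 * τ)
    have hL : 0 ≤ L := div_nonneg (by positivity) (by linarith)
    -- The first summand belongs to the remainder of `F`, the others to the Taylor tail; the powers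
    -- of `s` absorb the surplus exponents `M + a i - N ≥ 0`.
    refine ⟨Real.exp (b * K) * C + ∑ i ∈ Finset.range m, L * (s ^ (M + a i - N) * B i),
      fun β hβ x hx => ?_⟩
    have hr : 0 < ‖x - y₁‖ := norm_pos_iff.2 (sub_ne_zero.2 hx.2)
    have hrs : ‖x - y₁‖ ≤ s := by simpa [dist_eq_norm] using hx.1
    have hrt : ‖x - y₁‖ * ‖y₁ - y₂‖⁻¹ ≤ τ := mul_le_mul_of_nonneg_right hrs (by positivity)
    have hexp := exp_logDist hy hσ hx.2 (ne_of_mem_closedBall hs' hx.1) β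
    have hφ : ‖((‖x - y₂‖ / σ : ℝ) : ℂ) ^ β‖ ≤ Real.exp (b * K) := by
      rw [← hexp]
      refine norm_exp_mul_le hβ (hK _ ?_ _ (hn x hx))
      rw [mem_closedBall_zero_iff, Complex.norm_real, Real.norm_of_nonneg (by positivity)]
      linarith
    have htail : ‖((‖x - y₂‖ / σ : ℝ) : ℂ) ^ β - ∑ k ∈ Finset.range M,
        (‖x - y₁‖ : ℂ) ^ k * distCoeff y₁ y₂ σ k β (dir y₁ x)‖ ≤ L * ‖x - y₁‖ ^ M := by
      rw [← hexp]
      refine (norm_exp_logDist_sub_le hK M hβ (hn x hx) hr.le (hrt.trans_lt hst)).trans ?_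
      calc _ ≤ Real.exp (b * K) * (2 * (‖x - y₁‖ * ‖y₁ - y₂‖⁻¹)) ^ M / (1 - 2 * τ) := by
            gcongr
            linarith
        _ = _ := by
            simp only [L, mul_pow]
            ring
    rw [productRemainder_eq hx.2, add_mul, Finset.sum_mul, Real.rpow_natCast]
    refine (norm_add_le _ _).trans (add_le_add ?_ ((norm_sum_le _ _).trans
      (Finset.sum_le_sum fun i _ => ?_)))
    · rw [norm_mul, Complex.norm_real, Real.norm_eq_abs, mul_assoc]
      gcongr
      exact hC x hx
    · rw [norm_mul, norm_mul, Complex.norm_real, Complex.norm_real, Real.norm_eq_abs,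
        Real.norm_eq_abs, abs_of_pos (Real.rpow_pos_of_pos hr _)]
      have ha0 : a 0 ≤ a i := ha.monotone (Nat.zero_le i)
      have h1 := rpow_le_mul_rpow hr hrs (show (N : ℝ) ≤ M + a i by linarith)
      rw [Real.rpow_add hr, Real.rpow_natCast, Real.rpow_natCast] at h1
      calc _ ≤ L * ‖x - y₁‖ ^ M * (‖x - y₁‖ ^ a i * B i) := by
            gcongr
            exact hB i _ (hn x hx)
        _ = L * (‖x - y₁‖ ^ M * ‖x - y₁‖ ^ a i) * B i := by ring
        _ ≤ L * (s ^ (M + a i - N) * ‖x - y₁‖ ^ N) * B i := by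
            gcongr
            exact hB0 i
        _ = _ := by ring

/-- The angular integral of `productCoeff`. -/
def productAngular (y₁ y₂ : Space) (σ : ℝ) (f : ℕ → Space → ℝ) (j : ℕ × ℕ) (β : ℂ) : ℂ :=
  ∫ n : Metric.sphere (0 : Space) 1, productCoeff y₁ y₂ σ f j β n
    ∂(volume : Measure Space).toSphere

theorem continuous_productCoeff
    (hf : ∀ i, Continuous fun n : Metric.sphere (0 : Space) 1 => f i n) (j : ℕ × ℕ) (β : ℂ) :
    Continuous fun n : Metric.sphere (0 : Space) 1 => productCoeff y₁ y₂ σ f j β n :=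
  (Complex.continuous_ofReal.comp (hf _)).mul (continuous_distCoeff _ _)

theorem differentiable_productAngular
    (hf : ∀ i, Continuous fun n : Metric.sphere (0 : Space) 1 => f i n) (j : ℕ × ℕ) :
    Differentiable ℂ (productAngular y₁ y₂ σ f j) := by
  intro β₀
  obtain ⟨K, hK⟩ := exists_norm_logDist_le y₁ y₂ σ
  refine differentiableAt_integral_of_dominated (V := Metric.closedBall β₀ 1)
    (g := fun n : Metric.sphere (0 : Space) 1 => ‖(f j.1 n : ℂ)‖ *
      (Real.exp ((‖β₀‖ + 1) * K) * (2 * ‖((‖y₁ - y₂‖⁻¹ : ℝ) : ℂ)‖) ^ j.2))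
    (Metric.closedBall_mem_nhds _ one_pos)
    (fun β _ => (continuous_productCoeff hf j β).aestronglyMeasurable) ?_ ?_ ?_
  · exact Eventually.of_forall fun n β _ => (differentiable_distCoeff j.2 n.2 β).const_mul _
  · exact (integrable_of_continuous_sphere (g := fun n => (f j.1 n : ℂ))
      (Complex.continuous_ofReal.comp (hf _))).norm.mul_const _
  · refine Eventually.of_forall fun n β hβ => ?_
    rw [productCoeff, norm_mul]
    refine mul_le_mul_of_nonneg_left (norm_distCoeff_le hK _ ?_ n.2 _) (norm_nonneg _)
    have h3 := norm_le_norm_add_norm_sub' β β₀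
    rw [mem_closedBall_iff_norm] at hβ
    linarith

theorem productAngular_zero (i k : ℕ) :
    productAngular y₁ y₂ σ f (i, k) 0 = if k = 0 then (angularIntegral (f i) : ℂ) else 0 := by
  simp only [productAngular, productCoeff, distCoeff_zero]
  by_cases hk : k = 0
  · simp only [hk, if_true, mul_one]
    exact integral_ofReal
  · simp [hk]

theorem productRemainder_zero {m M : ℕ} (hM : 0 < M) {x : Space} (hx : x ≠ y₁) :
    productRemainder y₁ y₂ σ F a f m M 0 x = (remainder F y₁ a f m x : ℂ) := by
  have h1 : ∑ k ∈ Finset.range M,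
      (‖x - y₁‖ : ℂ) ^ k * distCoeff y₁ y₂ σ k 0 (dir y₁ x) = 1 := by
    simp only [distCoeff_zero, mul_ite, mul_one, mul_zero]
    rw [Finset.sum_ite_eq' _ _ _, if_pos (Finset.mem_range.2 hM), pow_zero]
  rw [productRemainder_eq hx, h1]
  simp

/-- The poles of the continued integral over a ball. -/
def poles (a : ℕ → ℝ) : Set ℂ :=
  Set.range fun j : ℕ × ℕ => ((-(productExponent a j + 3) : ℝ) : ℂ)

/-- To the right of `Re z - 1` only finitely many pairs `(i, k)` produce a pole: both `a i` and `k`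
are then bounded above. -/
theorem compl_poles_mem_codiscrete (h : IsSingularExpansion F y₁ a f) :
    (poles a)ᶜ ∈ codiscrete ℂ := by
  rw [mem_codiscrete]
  intro z
  rw [compl_compl, disjoint_principal_right]
  let N : ℕ := ⌈|z.re|⌉₊
  obtain ⟨m, hm, -⟩ := h.2 N
  obtain ⟨M, hM⟩ := exists_nat_ge ((N : ℝ) - a 0)
  let S : Set ℂ := (fun j : ℕ × ℕ => ((-(productExponent a j + 3) : ℝ) : ℂ)) ''
    (Finset.range m ×ˢ Finset.range M : Finset (ℕ × ℕ))
  have hS : S.Finite := (Finset.finite_toSet _).image _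
  have h1 : (S \ {z})ᶜ ∈ 𝓝 z := (hS.subset Set.sdiff_subset).isClosed.isOpen_compl.mem_nhds
    (fun h => h.2 rfl)
  have h2 : {w : ℂ | z.re - 1 < w.re} ∈ 𝓝 z :=
    (isOpen_lt continuous_const Complex.continuous_re).mem_nhds (sub_one_lt z.re)
  filter_upwards [self_mem_nhdsWithin, nhdsWithin_le_nhds h1, nhdsWithin_le_nhds h2]
    with w hwz hwS hwre
  rintro ⟨⟨i, k⟩, rfl⟩
  apply hwS
  refine ⟨⟨(i, k), ?_, rfl⟩, hwz⟩
  have hz : -(N : ℝ) ≤ z.re := by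
    linarith [neg_abs_le z.re, Nat.le_ceil |z.re|]
  have hwre' : z.re - 1 < -(a i + k + 3) := by simpa [productExponent] using hwre
  have ha0 : a 0 ≤ a i := h.1.monotone (Nat.zero_le i)
  have hk0 : (0 : ℝ) ≤ k := Nat.cast_nonneg k
  have hi : i < m := (hm i).2 (by linarith)
  have hk : k < M := by
    have : (k : ℝ) < M := by linarith
    exact_mod_cast this
  simp [hi, hk]

/-- The finite part of the integral over a ball. -/
def ballFinitePart (F : Space → ℝ) (y : Space) (a : ℕ → ℝ) (f : ℕ → Space → ℝ) (m : ℕ)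
    (σ s : ℝ) : ℝ :=
  (∑ i ∈ Finset.range m, radialFinitePart σ s (a i) * angularIntegral (f i)) +
    ∫ x in Metric.closedBall y s, remainder F y a f m x

end

/-! ### Analytic continuation of the integral over a ball -/

section

variable {y₁ y₂ : Space} {σ₁ σ₂ s : ℝ} {F : Space → ℝ} {a : ℕ → ℝ} {f : ℕ → Space → ℝ}

/-- The explicit continuation of the integral over a ball, to a half-plane that depends on the
order of the expansion. -/
def ballContinuation (y₁ y₂ : Space) (σ₁ σ₂ s : ℝ) (F : Space → ℝ) (a : ℕ → ℝ)
    (f : ℕ → Space → ℝ) (m M : ℕ) (α β : ℂ) : ℂ :=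
  (∑ j ∈ Finset.range m ×ˢ Finset.range M,
    radialIntegral σ₁ s (productExponent a j) α * productAngular y₁ y₂ σ₂ f j β) +
  ∫ x in Metric.closedBall y₁ s,
    ((‖x - y₁‖ / σ₁ : ℝ) : ℂ) ^ α * productRemainder y₁ y₂ σ₂ F a f m M β x

theorem analyticAt_ballContinuation (hσ₁ : 0 < σ₁) (hs : 0 < s)
    (hf : ∀ i, Continuous fun n : Metric.sphere (0 : Space) 1 => f i n) {N m M : ℕ}
    (hH : IsEntireFamily y₁ s N (productRemainder y₁ y₂ σ₂ F a f m M)) {p : ℂ × ℂ}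
    (hp : -(N : ℝ) - 3 < p.1.re) (hpa : p.1 ∉ poles a) :
    AnalyticAt ℂ (fun p : ℂ × ℂ => ballContinuation y₁ y₂ σ₁ σ₂ s F a f m M p.1 p.2) p := by
  refine AnalyticAt.add (Finset.analyticAt_fun_sum _ fun j _ => AnalyticAt.mul ?_ ?_)
    (hH.analyticAt hσ₁ hp)
  · refine AnalyticAt.comp (f := Prod.fst) (x := p) (analyticAt_radialIntegral hσ₁ hs ?_)
      analyticAt_fst
    exact fun h => hpa ⟨j, h.symm⟩
  · exact AnalyticAt.comp (f := Prod.snd) (x := p)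
      ((differentiable_productAngular hf j).analyticAt _) analyticAt_snd

theorem setIntegral_integrand_closedBall (hσ₁ : 0 < σ₁) (hs : 0 < s) (ha : StrictMono a)
    (hf : ∀ i, Continuous fun n : Metric.sphere (0 : Space) 1 => f i n) {N m M : ℕ}
    (hH : IsEntireFamily y₁ s N (productRemainder y₁ y₂ σ₂ F a f m M)) {α : ℂ} (β : ℂ)
    (hα : -(N : ℝ) - 3 < α.re) (hα' : -(a 0 + 3) < α.re) :
    IntegrableOn (integrand y₁ y₂ σ₁ σ₂ F α β) (Metric.closedBall y₁ s) ∧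
    ballContinuation y₁ y₂ σ₁ σ₂ s F a f m M α β =
      ∫ x in Metric.closedBall y₁ s, integrand y₁ y₂ σ₁ σ₂ F α β x := by
  have h1 := setIntegral_closedBall_of_expansion (T := Finset.range m ×ˢ Finset.range M)
    (e := productExponent a) (c := productCoeff y₁ y₂ σ₂ f)
    (Φ := fun β x => ((‖x - y₂‖ / σ₂ : ℝ) : ℂ) ^ β * (F x : ℂ)) hσ₁ hs
    (fun j _ β => continuous_productCoeff hf j β) hH β hα (fun j _ => by
      have ha0 : a 0 ≤ a j.1 := ha.monotone (Nat.zero_le _)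
      have hk0 : (0 : ℝ) ≤ j.2 := Nat.cast_nonneg _
      rw [productExponent]
      linarith)
  have h2 : integrand y₁ y₂ σ₁ σ₂ F α β = fun x => ((‖x - y₁‖ / σ₁ : ℝ) : ℂ) ^ α *
      (((‖x - y₂‖ / σ₂ : ℝ) : ℂ) ^ β * (F x : ℂ)) := by
    ext1 x
    rw [integrand, mul_assoc]
  rw [h2]
  exact ⟨h1.1, h1.2.symm⟩

theorem re_le_of_mem_poles (ha : StrictMono a) {z : ℂ} (hz : z ∈ poles a) :
    z.re ≤ -(a 0 + 3) := by
  obtain ⟨j, rfl⟩ := hz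
  have ha0 : a 0 ≤ a j.1 := ha.monotone (Nat.zero_le _)
  have hk0 : (0 : ℝ) ≤ j.2 := Nat.cast_nonneg _
  simp only [productExponent, Complex.ofReal_re]
  linarith

/-- The pole and the regular part at `α = 0` of the explicit continuation. -/
theorem ballContinuation_eq_pole_add (hσ₁ : 0 < σ₁) (hs : 0 < s)
    (hf : ∀ i, Continuous fun n : Metric.sphere (0 : Space) 1 => f i n) {N m M : ℕ} (hM : 0 < M)
    (hH : IsEntireFamily y₁ s N (productRemainder y₁ y₂ σ₂ F a f m M)) :
    ∃ (γ : ℂ → ℂ) (g : ℂ × ℂ → ℂ), AnalyticAt ℂ γ 0 ∧ AnalyticAt ℂ g (0, 0) ∧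
      g (0, 0) = (ballFinitePart F y₁ a f m σ₁ s : ℂ) ∧
      ∀ z w : ℂ, z ≠ 0 →
        ballContinuation y₁ y₂ σ₁ σ₂ s F a f m M z w = γ w / z + g (z, w) := by
  -- All pairs with `a i + k = -3` contribute to the residue, including those with `k > 0`, which is
  -- why it depends on `w`.
  refine ⟨fun w => ∑ j ∈ Finset.range m ×ˢ Finset.range M,
      (if productExponent a j = -3 then 1 else 0) * productAngular y₁ y₂ σ₂ f j w,
    fun p => (∑ j ∈ Finset.range m ×ˢ Finset.range M,
      radialRegular σ₁ s (productExponent a j) p.1 * productAngular y₁ y₂ σ₂ f j p.2) +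
      ∫ x in Metric.closedBall y₁ s,
        ((‖x - y₁‖ / σ₁ : ℝ) : ℂ) ^ p.1 * productRemainder y₁ y₂ σ₂ F a f m M p.2 x,
    ?_, ?_, ?_, ?_⟩
  · exact Finset.analyticAt_fun_sum _ fun j _ => analyticAt_const.mul
      ((differentiable_productAngular hf j).analyticAt _)
  · refine AnalyticAt.add (Finset.analyticAt_fun_sum _ fun j _ => AnalyticAt.mul ?_ ?_)
      (hH.analyticAt hσ₁ ?_)
    · exact AnalyticAt.comp (f := Prod.fst) (x := ((0 : ℂ), (0 : ℂ)))
        (analyticAt_radialRegular hσ₁ hs _) analyticAt_fst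
    · exact AnalyticAt.comp (f := Prod.snd) (x := ((0 : ℂ), (0 : ℂ)))
        ((differentiable_productAngular hf j).analyticAt _) analyticAt_snd
    · have : (0 : ℝ) ≤ N := Nat.cast_nonneg N
      simp only [Complex.zero_re]
      linarith
  · simp only [ballFinitePart, Complex.ofReal_add, Complex.ofReal_sum, Complex.ofReal_mul]
    congr 1
    · rw [Finset.sum_product]
      refine Finset.sum_congr rfl fun i _ => ?_
      -- At `β = 0` every term with `k > 0` drops out, so only the exponents of `F` itself enter the
      -- finite part.
      simp only [productAngular_zero, mul_ite, mul_zero]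
      rw [Finset.sum_ite_eq' _ _ _, if_pos (Finset.mem_range.2 hM), radialRegular_zero hσ₁ hs]
      simp [productExponent]
    · rw [← integral_complex_ofReal]
      refine integral_congr_ae ?_
      filter_upwards [ae_mem_closedBall_diff y₁ s] with x hx
      rw [Complex.cpow_zero, one_mul, productRemainder_zero hM hx.2]
  · intro z w hz
    rw [ballContinuation, Finset.sum_div, ← add_assoc, ← Finset.sum_add_distrib]
    congr 1
    refine Finset.sum_congr rfl fun j _ => ?_
    rw [radialIntegral_eq _ _ _ hz]
    ring

/-- The integral over a ball around `y₁` has a continuation in `α`, with a simple pole at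
`α = 0`. -/
theorem exists_isContinuation_closedBall (hy : y₁ ≠ y₂) (hσ₁ : 0 < σ₁) (hσ₂ : 0 < σ₂) (hs : 0 < s)
    (hs' : s < ‖y₁ - y₂‖ / 2) (hF : ContinuousOn F (Metric.closedBall y₁ s \ {y₁}))
    (h : IsSingularExpansion F y₁ a f) {m₀ : ℕ} (hm₀ : ∀ i, i < m₀ ↔ a i ≤ 0) :
    ∃ J : ℂ → ℂ → ℂ,
      IsContinuation (fun α β => integrand y₁ y₂ σ₁ σ₂ F α β) (Metric.closedBall y₁ s) J ∧
      ∃ (γ : ℂ → ℂ) (g : ℂ × ℂ → ℂ), AnalyticAt ℂ γ 0 ∧ AnalyticAt ℂ g (0, 0) ∧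
        g (0, 0) = (ballFinitePart F y₁ a f m₀ σ₁ s : ℂ) ∧
        ∀ᶠ z in 𝓝[≠] (0 : ℂ), ∀ w : ℂ, J z w = γ w / z + g (z, w) := by
  have hf := h.continuous_coeff hs hF
  have hN : ∀ N : ℕ, ∃ m M : ℕ, 0 < M ∧ (∀ i, i < m ↔ a i ≤ (N : ℝ)) ∧
      IsEntireFamily y₁ s N (productRemainder y₁ y₂ σ₂ F a f m M) := by
    intro N
    obtain ⟨m, hm, hR⟩ := h.exists_remainder_bound hs hF N
    obtain ⟨M, hM⟩ := exists_nat_ge ((N : ℝ) - a 0)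
    -- The extra Taylor term guarantees that the term `k = 0` is present, as the evaluation at `β =
    -- 0` requires.
    refine ⟨m, M + 1, Nat.succ_pos _, hm, isEntireFamily_productRemainder hy hσ₂ hs' hF hf h.1
      hR ?_⟩
    push_cast
    linarith
  choose m M hM hm hH using hN
  have hD := compl_poles_mem_codiscrete h
  -- The bound `-(a 0 + 3)` makes all explicit terms integrable, and `-3` the remainder, for every
  -- order `N` at once.
  have hA : ∀ (N : ℕ) (z : ℂ), max (-(a 0 + 3)) (-3) < z.re →
      -(N : ℝ) - 3 < z.re ∧ -(a 0 + 3) < z.re := by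
    intro N z hz
    have : (0 : ℝ) ≤ N := Nat.cast_nonneg N
    exact ⟨by linarith [(le_max_right _ _).trans_lt hz], (le_max_left _ _).trans_lt hz⟩
  obtain ⟨J, hJ, hJN⟩ := exists_isContinuation_of_halfPlanes
    (h := fun α β => integrand y₁ y₂ σ₁ σ₂ F α β) (B := Metric.closedBall y₁ s) hD
    (A := max (-(a 0 + 3)) (-3))
    (fun z hz hzD => (re_le_of_mem_poles h.1 hzD).not_gt (hA 0 z hz).2)
    (fun z w hz => (setIntegral_integrand_closedBall hσ₁ hs h.1 hf (hH 0) w (hA 0 z hz).1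
      (hA 0 z hz).2).1)
    (fun N => ballContinuation y₁ y₂ σ₁ σ₂ s F a f (m N) (M N))
    (fun N p hp => analyticAt_ballContinuation hσ₁ hs hf (hH N) (by linarith [hp.1]) hp.2)
    (fun N z w hz => (setIntegral_integrand_closedBall hσ₁ hs h.1 hf (hH N) w (hA N z hz).1
      (hA N z hz).2).2)
  refine ⟨J, hJ, ?_⟩
  -- Order `0` is already enough near the origin, because its half-plane reaches beyond it to the
  -- left.
  obtain ⟨γ, g, hγ, hg, hg0, hJg⟩ := ballContinuation_eq_pole_add hσ₁ hs hf (hM 0) (hH 0)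
  have hmm : m 0 = m₀ := by
    have h1 : ∀ i, i < m 0 ↔ i < m₀ := fun i => by rw [hm 0 i, hm₀ i, Nat.cast_zero]
    exact le_antisymm (not_lt.1 fun h2 => lt_irrefl _ ((h1 m₀).1 h2))
      (not_lt.1 fun h2 => lt_irrefl _ ((h1 (m 0)).2 h2))
  rw [hmm] at hg0
  refine ⟨γ, g, hγ, hg, hg0, ?_⟩
  have h1 : (poles a)ᶜ ∈ 𝓝[≠] (0 : ℂ) := by
    have := mem_codiscrete.1 hD 0
    rwa [compl_compl, disjoint_principal_right] at this
  have h2 : {w : ℂ | -1 < w.re} ∈ 𝓝 (0 : ℂ) :=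
    (isOpen_lt continuous_const Complex.continuous_re).mem_nhds (by simp)
  filter_upwards [h1, nhdsWithin_le_nhds h2, self_mem_nhdsWithin] with z hz hz' hz0 w
  have hz'' : -1 < z.re := hz'
  rw [hJN 0 z w (by simpa using hz'') hz, hJg z w hz0]

end

/-! ### The integral outside the balls -/

/-- The space outside two balls of radius `s`. -/
def outside (y₁ y₂ : Space) (s : ℝ) : Set Space :=
  (Metric.closedBall y₁ s ∪ Metric.closedBall y₂ s)ᶜ

theorem isOpen_outside (y₁ y₂ : Space) (s : ℝ) : IsOpen (outside y₁ y₂ s) :=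
  (Metric.isClosed_closedBall.union Metric.isClosed_closedBall).isOpen_compl

theorem mem_outside {y₁ y₂ : Space} {s : ℝ} {x : Space} :
    x ∈ outside y₁ y₂ s ↔ s < ‖x - y₁‖ ∧ s < ‖x - y₂‖ := by
  simp [outside, dist_eq_norm]

section

variable {y₁ y₂ : Space} {s : ℝ} {F : Space → ℝ}

theorem outside_subset (hs : 0 < s) : outside y₁ y₂ s ⊆ {y₁, y₂}ᶜ := by
  intro x hx
  rw [mem_outside] at hx
  rintro (rfl | rfl)
  · rw [sub_self, norm_zero] at hx
    exact hs.not_gt hx.1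
  · rw [sub_self, norm_zero] at hx
    exact hs.not_gt hx.2

/-- The weight `1 + ‖x‖` replaces `‖x‖` so as to have one majorant on the whole region. Far away `1
+ ‖x‖ ≤ 2 * ‖x‖`, hence the requirement `R ≥ 1`; the bounded part is covered by a compact set away
from the singular points. -/
theorem exists_integrableOn_outside (hs : 0 < s) (hF : ContinuousOn F {y₁, y₂}ᶜ)
    (hinf : SummableAtInfinity F) :
    ∃ ε : ℝ, 0 < ε ∧ IntegrableOn (fun x => (1 + ‖x‖) ^ ε * |F x|) (outside y₁ y₂ s) := by
  obtain ⟨ε, hε, U, hU, hint⟩ := hinf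
  refine ⟨ε, hε, ?_⟩
  obtain ⟨R₀, hR₀⟩ := (Metric.closedBall_compl_subset_of_mem_cocompact hU 0)
  set R := max R₀ 1
  have hRU : (Metric.closedBall (0 : Space) R)ᶜ ⊆ U := by
    refine Set.Subset.trans ?_ hR₀
    exact Set.compl_subset_compl.2 (Metric.closedBall_subset_closedBall (le_max_left _ _))
  have hcont : ContinuousOn (fun x => (1 + ‖x‖) ^ ε * |F x|) {y₁, y₂}ᶜ := by
    refine ContinuousOn.mul (Continuous.continuousOn ?_) hF.abs
    exact Continuous.rpow_const (by fun_prop) fun x => Or.inr hε.le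
  have h1 : IntegrableOn (fun x => (1 + ‖x‖) ^ ε * |F x|)
      (Metric.closedBall 0 R \ (Metric.ball y₁ s ∪ Metric.ball y₂ s)) := by
    refine ContinuousOn.integrableOn_compact ((isCompact_closedBall _ _).diff
      (Metric.isOpen_ball.union Metric.isOpen_ball)) (hcont.mono ?_)
    rintro x hx (rfl | rfl)
    · exact hx.2 (Or.inl (Metric.mem_ball_self hs))
    · exact hx.2 (Or.inr (Metric.mem_ball_self hs))
  have hmeas : MeasurableSet (outside y₁ y₂ s \ Metric.closedBall 0 R) :=
    (isOpen_outside y₁ y₂ s).measurableSet.diff Metric.isClosed_closedBall.measurableSet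
  have h2 : IntegrableOn (fun x => (1 + ‖x‖) ^ ε * |F x|)
      (outside y₁ y₂ s \ Metric.closedBall 0 R) := by
    have h3 : IntegrableOn (fun x => ‖x‖ ^ ε * F x) (outside y₁ y₂ s \ Metric.closedBall 0 R) :=
      hint.mono_set fun x hx => hRU hx.2
    refine Integrable.mono' (h3.norm.const_mul (2 ^ ε)) ?_ ?_
    · exact (hcont.mono fun x hx => outside_subset hs hx.1).aestronglyMeasurable hmeas
    · filter_upwards [ae_restrict_mem hmeas] with x hx
      have hx1 : 1 < ‖x‖ := by
        have := hx.2
        rw [mem_closedBall_zero_iff, not_le] at this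
        exact (le_max_right _ _).trans_lt this
      rw [Real.norm_of_nonneg (by positivity), norm_mul, Real.norm_eq_abs (F x),
        Real.norm_of_nonneg (by positivity), ← mul_assoc,
        ← Real.mul_rpow (by norm_num) (norm_nonneg _)]
      gcongr
      linarith
  refine (h1.union h2).mono_set fun x hx => ?_
  by_cases hxR : x ∈ Metric.closedBall 0 R
  · refine Or.inl ⟨hxR, ?_⟩
    rw [mem_outside] at hx
    rintro (h | h)
    · rw [mem_ball_iff_norm] at h
      exact h.not_gt hx.1
    · rw [mem_ball_iff_norm] at h
      exact h.not_gt hx.2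
  · exact Or.inr ⟨hx, hxR⟩

theorem integrableOn_outside (hs : 0 < s) (hF : ContinuousOn F {y₁, y₂}ᶜ)
    (hinf : SummableAtInfinity F) : IntegrableOn F (outside y₁ y₂ s) := by
  obtain ⟨ε, hε, h⟩ := exists_integrableOn_outside hs hF hinf
  refine Integrable.mono' h ((hF.mono (outside_subset hs)).aestronglyMeasurable
    (isOpen_outside y₁ y₂ s).measurableSet) (Eventually.of_forall fun x => ?_)
  rw [Real.norm_eq_abs]
  refine le_mul_of_one_le_left (abs_nonneg _) (Real.one_le_rpow ?_ hε.le)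
  linarith [norm_nonneg x]

theorem exists_rpow_le_mul_rpow_one_add_norm (y : Space) {σ δ : ℝ} (hσ : 0 < σ) (hs : 0 < s)
    (hδ : 0 ≤ δ) : ∃ C : ℝ, ∀ x : Space, s ≤ ‖x - y‖ → ∀ t : ℝ, |t| ≤ δ →
      (‖x - y‖ / σ) ^ t ≤ C * (1 + ‖x‖) ^ δ := by
  refine ⟨(s / σ) ^ (-δ) + ((1 + ‖y‖) / σ) ^ δ, fun x hx t ht => ?_⟩
  have hpos : 0 < ‖x - y‖ / σ := div_pos (hs.trans_le hx) hσ
  refine (rpow_le_rpow_add_rpow hpos (abs_le.1 ht).1 (abs_le.1 ht).2).trans ?_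
  rw [add_mul, ← Real.mul_rpow (by positivity) (by positivity)]
  refine add_le_add ?_ (Real.rpow_le_rpow hpos.le ?_ hδ)
  · refine (Real.rpow_le_rpow_of_nonpos (div_pos hs hσ) (by gcongr) (neg_nonpos.2 hδ)).trans ?_
    refine le_mul_of_one_le_right (by positivity) (Real.one_le_rpow ?_ hδ)
    linarith [norm_nonneg x]
  · rw [div_mul_eq_mul_div]
    gcongr
    nlinarith [norm_sub_le x y, norm_nonneg x, norm_nonneg y]

theorem continuousOn_integrand {σ₁ σ₂ : ℝ} (hσ₁ : 0 < σ₁) (hσ₂ : 0 < σ₂)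
    (hF : ContinuousOn F {y₁, y₂}ᶜ) (α β : ℂ) :
    ContinuousOn (integrand y₁ y₂ σ₁ σ₂ F α β) {y₁, y₂}ᶜ := by
  have h1 : ∀ (y : Space) (σ : ℝ) (α : ℂ), 0 < σ → y ∈ ({y₁, y₂} : Set Space) →
      ContinuousOn (fun x : Space => ((‖x - y‖ / σ : ℝ) : ℂ) ^ α) {y₁, y₂}ᶜ := by
    intro y σ α hσ hy x hx
    have hxy : x ≠ y := fun h => hx (h ▸ hy)
    have hpos : 0 < ‖x - y‖ / σ := div_pos (norm_pos_iff.2 (sub_ne_zero.2 hxy)) hσ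
    have h2 : ContinuousAt (fun z : ℂ => z ^ α) ((‖x - y‖ / σ : ℝ) : ℂ) :=
      continuousAt_cpow_const (Or.inl (by simpa using hpos))
    exact (h2.comp (f := fun x : Space => ((‖x - y‖ / σ : ℝ) : ℂ))
      (by fun_prop)).continuousWithinAt
  exact ((h1 y₁ σ₁ α hσ₁ (by simp)).mul (h1 y₂ σ₂ β hσ₂ (by simp))).mul
    (Complex.continuous_ofReal.comp_continuousOn hF)

/-- The part of the integral outside the balls converges for small exponents and is analytic
there. -/
theorem exists_analyticAt_outside {σ₁ σ₂ : ℝ} (hσ₁ : 0 < σ₁) (hσ₂ : 0 < σ₂) (hs : 0 < s)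
    (hF : ContinuousOn F {y₁, y₂}ᶜ) (hinf : SummableAtInfinity F) :
    (∃ δ : ℝ, 0 < δ ∧ ∀ α β : ℂ, ‖α‖ < δ → ‖β‖ < δ →
      IntegrableOn (integrand y₁ y₂ σ₁ σ₂ F α β) (outside y₁ y₂ s)) ∧
    AnalyticAt ℂ (fun p : ℂ × ℂ =>
      ∫ x in outside y₁ y₂ s, integrand y₁ y₂ σ₁ σ₂ F p.1 p.2 x) (0, 0) := by
  obtain ⟨ε, hε, hint⟩ := exists_integrableOn_outside hs hF hinf
  -- The room `ε` at infinity is shared equally by the two powers.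
  have hδ : 0 < ε / 2 := half_pos hε
  obtain ⟨C₁, hC₁⟩ := exists_rpow_le_mul_rpow_one_add_norm y₁ hσ₁ hs hδ.le
  obtain ⟨C₂, hC₂⟩ := exists_rpow_le_mul_rpow_one_add_norm y₂ hσ₂ hs hδ.le
  have hmO := (isOpen_outside y₁ y₂ s).measurableSet
  have hmeas : ∀ α β : ℂ, AEStronglyMeasurable (integrand y₁ y₂ σ₁ σ₂ F α β)
      (volume.restrict (outside y₁ y₂ s)) := fun α β =>
    ((continuousOn_integrand hσ₁ hσ₂ hF α β).mono (outside_subset hs)).aestronglyMeasurable hmO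
  have hbound : ∀ x ∈ outside y₁ y₂ s, ∀ α β : ℂ, ‖α‖ < ε / 2 → ‖β‖ < ε / 2 →
      ‖integrand y₁ y₂ σ₁ σ₂ F α β x‖ ≤ C₁ * C₂ * ((1 + ‖x‖) ^ ε * |F x|) := by
    intro x hx α β hα hβ
    rw [mem_outside] at hx
    have hp₁ : 0 < ‖x - y₁‖ / σ₁ := div_pos (hs.trans hx.1) hσ₁
    have hp₂ : 0 < ‖x - y₂‖ / σ₂ := div_pos (hs.trans hx.2) hσ₂
    rw [integrand, norm_mul, norm_mul, norm_cpow_ofReal hp₁, norm_cpow_ofReal hp₂,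
      Complex.norm_real, Real.norm_eq_abs]
    have h1 := hC₁ x hx.1.le α.re ((Complex.abs_re_le_norm α).trans hα.le)
    have h2 := hC₂ x hx.2.le β.re ((Complex.abs_re_le_norm β).trans hβ.le)
    have h3 : (1 + ‖x‖) ^ ε = (1 + ‖x‖) ^ (ε / 2) * (1 + ‖x‖) ^ (ε / 2) := by
      rw [← Real.rpow_add (by positivity), add_halves]
    calc _ ≤ C₁ * (1 + ‖x‖) ^ (ε / 2) * (C₂ * (1 + ‖x‖) ^ (ε / 2)) * |F x| := by
          refine mul_le_mul_of_nonneg_right (mul_le_mul h1 h2 (by positivity) ?_) (abs_nonneg _)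
          exact (Real.rpow_nonneg hp₁.le _).trans h1
      _ = _ := by rw [h3]; ring
  refine ⟨⟨ε / 2, hδ, fun α β hα hβ => ?_⟩, ?_⟩
  · refine Integrable.mono' (hint.const_mul (C₁ * C₂)) (hmeas α β) ?_
    filter_upwards [ae_restrict_mem hmO] with x hx
    exact hbound x hx α β hα hβ
  · refine analyticAt_integral_of_dominated
      (V := Metric.ball (0 : ℂ) (ε / 2) ×ˢ Metric.ball (0 : ℂ) (ε / 2))
      ((Metric.isOpen_ball.prod Metric.isOpen_ball).mem_nhds
        ⟨Metric.mem_ball_self hδ, Metric.mem_ball_self hδ⟩)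
      (fun p _ => hmeas p.1 p.2) ?_ (hint.const_mul (C₁ * C₂)) ?_
    · filter_upwards [ae_restrict_mem hmO] with x hx p _
      rw [mem_outside] at hx
      exact (((differentiable_const_cpow_ofReal (div_pos (hs.trans hx.1) hσ₁)).comp
        differentiable_fst _).mul
        ((differentiable_const_cpow_ofReal (div_pos (hs.trans hx.2) hσ₂)).comp
          differentiable_snd _)).mul_const _
    · filter_upwards [ae_restrict_mem hmO] with x hx p hp
      exact hbound x hx p.1 p.2 (by simpa using hp.1) (by simpa using hp.2)

end

/-! ### Change of radius and the limit of small balls -/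

section

variable {y : Space} {σ s s' : ℝ} {F : Space → ℝ} {a : ℕ → ℝ} {f : ℕ → Space → ℝ}

/-- As a function of the radius, `radialFinitePart` is a primitive of `r ^ (e + 2)`, also for `e =
-3`; the scale `σ` cancels in the difference. -/
theorem setIntegral_radius_Ioc_rpow (hσ : 0 < σ) (hs' : 0 < s') (hss : s' ≤ s) (e : ℝ)
    (g : Space → ℝ) :
    ∫ x in {x : Space | ‖x - y‖ ∈ Set.Ioc s' s}, ‖x - y‖ ^ e * g (dir y x) =
      (radialFinitePart σ s e - radialFinitePart σ s' e) * angularIntegral g := by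
  have hs : 0 < s := hs'.trans_le hss
  rw [setIntegral_polar y measurableSet_Ioc (fun r => r ^ e) g, angularIntegral]
  congr 1
  have hsub : Set.Ioi 0 ∩ Set.Ioc s' s = Set.Ioc s' s :=
    Set.inter_eq_right.2 fun r hr => hs'.trans hr.1
  have h1 : ∀ r ∈ Set.Ioc s' s, r ^ 2 • r ^ e = r ^ (e + 2) := by
    intro r hr
    rw [Real.rpow_add (hs'.trans hr.1), smul_eq_mul, mul_comm, Real.rpow_two]
  rw [hsub, setIntegral_congr_fun measurableSet_Ioc h1, ← intervalIntegral.integral_of_le hss]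
  have h0 : (0 : ℝ) ∉ Set.uIcc s' s := by
    rw [Set.uIcc_of_le hss]
    exact fun h => hs'.not_ge h.1
  by_cases he : e = -3
  · rw [radialFinitePart, radialFinitePart, if_pos he, if_pos he, he]
    norm_num
    have h2 : ∀ r : ℝ, r ^ (-1 : ℝ) = r⁻¹ := Real.rpow_neg_one
    simp only [h2]
    rw [integral_inv h0, Real.log_div hs.ne' hs'.ne', Real.log_div hs.ne' hσ.ne',
      Real.log_div hs'.ne' hσ.ne']
    ring
  · rw [radialFinitePart, radialFinitePart, if_neg he, if_neg he,
      integral_rpow (Or.inr ⟨fun h => he (by linarith), h0⟩), ← sub_div]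
    norm_num [add_assoc]

theorem closedBall_eq_union_radius_Ioc (y : Space) (hss : s' ≤ s) :
    Metric.closedBall y s = Metric.closedBall y s' ∪ {x : Space | ‖x - y‖ ∈ Set.Ioc s' s} := by
  ext x
  simp only [mem_closedBall_iff_norm, Set.mem_union, Set.mem_ofPred_eq, Set.mem_Ioc]
  constructor
  · intro h
    by_cases h' : ‖x - y‖ ≤ s'
    · exact Or.inl h'
    · exact Or.inr ⟨not_le.1 h', h⟩
  · rintro (h | h)
    · exact h.trans hss
    · exact h.2

theorem measurableSet_radius_Ioc (y : Space) (s' s : ℝ) :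
    MeasurableSet {x : Space | ‖x - y‖ ∈ Set.Ioc s' s} :=
  (by fun_prop : Measurable fun x : Space => ‖x - y‖) measurableSet_Ioc

theorem disjoint_closedBall_radius_Ioc (y : Space) (s' s : ℝ) :
    Disjoint (Metric.closedBall y s') {x : Space | ‖x - y‖ ∈ Set.Ioc s' s} := by
  rw [Set.disjoint_left]
  intro x hx hx'
  rw [mem_closedBall_iff_norm] at hx
  exact hx.not_gt hx'.1

theorem integrableOn_radius_Ioc {G : Space → ℝ} (hs' : 0 < s')
    (hG : ContinuousOn G (Metric.closedBall y s \ {y})) :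
    IntegrableOn G {x : Space | ‖x - y‖ ∈ Set.Ioc s' s} := by
  have hcompact : IsCompact (Metric.closedBall y s \ Metric.ball y s') :=
    (isCompact_closedBall y s).diff Metric.isOpen_ball
  refine (ContinuousOn.integrableOn_compact hcompact (hG.mono ?_)).mono_set ?_
  · exact fun x hx => ⟨hx.1, fun hxy => hx.2 (by rw [hxy]; exact Metric.mem_ball_self hs')⟩
  · intro x hx
    refine ⟨by simpa [dist_eq_norm] using hx.2, ?_⟩
    rw [mem_ball_iff_norm]
    exact hx.1.not_gt

theorem integrableOn_remainder (hF : ContinuousOn F (Metric.closedBall y s \ {y}))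
    (hf : ∀ i, Continuous fun n : Metric.sphere (0 : Space) 1 => f i n) {m : ℕ} {C : ℝ}
    (hC : ∀ x ∈ Metric.closedBall y s \ {y}, |remainder F y a f m x| ≤ C) :
    IntegrableOn (remainder F y a f m) (Metric.closedBall y s) := by
  refine Integrable.mono' (g := fun _ => C) (integrableOn_const measure_closedBall_lt_top.ne)
    (aestronglyMeasurable_of_continuousOn_compl_singleton (y := y)
      Metric.isClosed_closedBall.measurableSet (continuousOn_remainder hF hf m)) ?_
  filter_upwards [ae_mem_closedBall_diff y s] with x hx
  exact hC x hx

/-- On the shell the explicit terms and the remainder add up to `F` again, and the explicit terms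
integrate to the differences of their finite parts. -/
theorem ballFinitePart_sub (hσ : 0 < σ) (hs' : 0 < s') (hss : s' ≤ s)
    (hF : ContinuousOn F (Metric.closedBall y s \ {y}))
    (hf : ∀ i, Continuous fun n : Metric.sphere (0 : Space) 1 => f i n) {m : ℕ} {C : ℝ}
    (hC : ∀ x ∈ Metric.closedBall y s \ {y}, |remainder F y a f m x| ≤ C) :
    ballFinitePart F y a f m σ s =
      ballFinitePart F y a f m σ s' + ∫ x in {x : Space | ‖x - y‖ ∈ Set.Ioc s' s}, F x := by
  have hrem := integrableOn_remainder hF hf hC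
  have hsub := closedBall_eq_union_radius_Ioc y hss
  rw [ballFinitePart, ballFinitePart, hsub,
    setIntegral_union (disjoint_closedBall_radius_Ioc y s' s)
    (measurableSet_radius_Ioc y s' s) (hrem.mono_set (by rw [hsub]; exact Set.subset_union_left))
    (hrem.mono_set (by rw [hsub]; exact Set.subset_union_right))]
  have hterm : ∀ i, IntegrableOn (fun x => ‖x - y‖ ^ a i * f i (dir y x))
      {x : Space | ‖x - y‖ ∈ Set.Ioc s' s} := by
    intro i
    refine integrableOn_radius_Ioc hs' (ContinuousOn.mul (fun x hx => ?_)
      ((continuousOn_comp_dir y (hf i)).mono fun x hx => hx.2))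
    exact (ContinuousAt.rpow_const (f := fun x : Space => ‖x - y‖) (by fun_prop)
      (Or.inl (norm_ne_zero_iff.2 (sub_ne_zero.2 hx.2)))).continuousWithinAt
  have h1 : ∫ x in {x : Space | ‖x - y‖ ∈ Set.Ioc s' s}, remainder F y a f m x =
      (∫ x in {x : Space | ‖x - y‖ ∈ Set.Ioc s' s}, F x) - ∑ i ∈ Finset.range m,
        (radialFinitePart σ s (a i) - radialFinitePart σ s' (a i)) * angularIntegral (f i) := by
    simp only [remainder]
    rw [integral_sub (integrableOn_radius_Ioc hs' hF)
      (integrable_finsetSum _ fun i _ => hterm i), integral_finsetSum _ fun i _ => hterm i]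
    congr 1
    exact Finset.sum_congr rfl fun i _ => setIntegral_radius_Ioc_rpow hσ hs' hss _ _
  rw [h1]
  simp only [sub_mul, Finset.sum_sub_distrib]
  ring

theorem counterterm_eq {m : ℕ} (hm : ∀ i, i < m ↔ a i ≤ 0) (σ s : ℝ) :
    counterterm a f σ s = ∑ i ∈ Finset.range m,
      (if a i + 3 ≤ 0 then radialFinitePart σ s (a i) else 0) * angularIntegral (f i) := by
  have h1 : ∀ (p : ℕ → Prop) [DecidablePred p] (v : ℕ → ℝ), (∀ i, p i → a i ≤ 0) →
      ∑ᶠ (i : ℕ) (_ : p i), v i = ∑ i ∈ Finset.range m, if p i then v i else 0 := by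
    intro p _ v hp
    rw [← Finset.sum_filter]
    refine finsum_cond_eq_sum_of_cond_iff v fun {i} _ => ?_
    rw [Finset.mem_filter, Finset.mem_range, hm]
    exact ⟨fun h => ⟨hp i h, h⟩, fun h => h.2⟩
  rw [counterterm, h1 _ _ fun i hi => by linarith, h1 _ _ fun i hi => by linarith,
    ← Finset.sum_add_distrib]
  refine Finset.sum_congr rfl fun i _ => ?_
  rcases lt_trichotomy (a i + 3) 0 with h | h | h
  · have h3 : a i ≠ -3 := fun h3 => by linarith
    rw [if_pos h, if_neg h3, if_pos h.le, radialFinitePart, if_neg h3, add_zero]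
  · have h3 : a i = -3 := by linarith
    rw [if_neg h.not_lt, if_pos h3, if_pos h.le, radialFinitePart, if_pos h3, zero_add]
  · have h3 : a i ≠ -3 := fun h3 => by linarith
    rw [if_neg h.not_gt, if_neg h3, if_neg h.not_ge, add_zero, zero_mul]

/-- The counterterms are the finite parts of the explicit terms with `a i ≤ -3`. What is left are
powers `t ^ (a i + 3)` with positive exponent and the integral of a bounded remainder over a ball of
volume proportional to `t ^ 3`. -/
theorem tendsto_ballFinitePart_sub_counterterm (hs : 0 < s) {m : ℕ} (hm : ∀ i, i < m ↔ a i ≤ 0)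
    {C : ℝ} (hC : ∀ x ∈ Metric.closedBall y s \ {y}, |remainder F y a f m x| ≤ C) (σ : ℝ) :
    Tendsto (fun t => ballFinitePart F y a f m σ t - counterterm a f σ t) (𝓝[>] 0) (𝓝 0) := by
  have h1 : Tendsto (fun t => ∫ x in Metric.closedBall y t, remainder F y a f m x) (𝓝[>] 0)
      (𝓝 0) := by
    have hvol : Tendsto (fun t : ℝ => C * (t ^ 3 * (volume : Measure Space).real (Metric.ball 0 1)))
        (𝓝[>] 0) (𝓝 0) := by
      have : Continuous fun t : ℝ =>
          C * (t ^ 3 * (volume : Measure Space).real (Metric.ball 0 1)) := by fun_prop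
      refine (this.tendsto' 0 0 (by simp)).mono_left nhdsWithin_le_nhds
    refine squeeze_zero_norm' ?_ hvol
    filter_upwards [Ioo_mem_nhdsGT hs] with t ht
    have h2 := norm_setIntegral_le_of_norm_le_const_ae (μ := (volume : Measure Space))
      (s := Metric.closedBall y t) (f := remainder F y a f m) (C := C)
      measure_closedBall_lt_top (by
        filter_upwards [ae_mem_closedBall_diff y t] with x hx
        exact hC x ⟨Metric.closedBall_subset_closedBall ht.2.le hx.1, hx.2⟩)
    refine h2.trans_eq ?_
    rw [Measure.addHaar_real_closedBall _ _ ht.1.le]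
    simp
  have h2 : ∀ i, Tendsto (fun t : ℝ =>
      (if a i + 3 ≤ 0 then 0 else radialFinitePart σ t (a i)) * angularIntegral (f i)) (𝓝[>] 0)
      (𝓝 0) := by
    intro i
    by_cases h : a i + 3 ≤ 0
    · simp [h]
    · have h3 : a i ≠ -3 := fun h3 => h (by linarith)
      simp only [h, if_false, radialFinitePart, h3]
      have h4 : Tendsto (fun t : ℝ => t ^ (a i + 3)) (𝓝[>] 0) (𝓝 0) := by
        have := (Real.continuousAt_rpow_const 0 (a i + 3) (Or.inr (not_le.1 h).le)).tendsto
        rw [Real.zero_rpow (not_le.1 h).ne'] at this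
        exact this.mono_left nhdsWithin_le_nhds
      simpa using (h4.div_const (a i + 3)).mul_const (angularIntegral (f i))
  have h3 := (tendsto_finsetSum (Finset.range m) fun i _ => h2 i).add h1
  simp only [Finset.sum_const_zero, add_zero] at h3
  refine h3.congr fun t => ?_
  rw [ballFinitePart, counterterm_eq hm, add_sub_right_comm, ← Finset.sum_sub_distrib]
  congr 1
  refine Finset.sum_congr rfl fun i _ => ?_
  split_ifs <;> ring

end

/-! ### Comparison of the partie finie with the iterated finite parts -/

theorem HasIteratedFinitePart.unique {J : ℂ → ℂ → ℂ} {c c' : ℂ} (h : HasIteratedFinitePart J c)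
    (h' : HasIteratedFinitePart J c') : c = c' := by
  obtain ⟨G, hG, hGc⟩ := h
  obtain ⟨G', hG', hGc'⟩ := h'
  refine hGc.unique (hGc'.congr ?_)
  filter_upwards [hG, hG'] with w hw hw'
  exact hw.unique hw'

section

variable {y₁ y₂ : Space} {s₁ s₂ s s' : ℝ} {F : Space → ℝ} {a b : ℕ → ℝ} {f g : ℕ → Space → ℝ}

/-- The partie finie computed with balls of a fixed radius `s`. -/
def partieFinieAt (y₁ y₂ : Space) (s₁ s₂ : ℝ) (F : Space → ℝ) (a : ℕ → ℝ) (f : ℕ → Space → ℝ)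
    (b : ℕ → ℝ) (g : ℕ → Space → ℝ) (m n : ℕ) (s : ℝ) : ℝ :=
  (∫ x in outside y₁ y₂ s, F x) + ballFinitePart F y₁ a f m s₁ s + ballFinitePart F y₂ b g n s₂ s

theorem continuousOn_closedBall_left (hF : ContinuousOn F {y₁, y₂}ᶜ) (hs' : s < ‖y₁ - y₂‖ / 2) :
    ContinuousOn F (Metric.closedBall y₁ s \ {y₁}) := by
  refine hF.mono fun x hx => ?_
  rintro (h | h)
  · exact hx.2 h
  · exact ne_of_mem_closedBall hs' hx.1 h

theorem continuousOn_closedBall_right (hF : ContinuousOn F {y₁, y₂}ᶜ) (hs' : s < ‖y₁ - y₂‖ / 2) :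
    ContinuousOn F (Metric.closedBall y₂ s \ {y₂}) := by
  rw [Set.pair_comm] at hF
  exact continuousOn_closedBall_left hF (by rwa [norm_sub_rev])

theorem IsSingularExpansion.exists_bound {y : Space} (h : IsSingularExpansion F y a f) {m : ℕ}
    (hm : ∀ i, i < m ↔ a i ≤ 0) (hs : 0 < s) (hF : ContinuousOn F (Metric.closedBall y s \ {y})) :
    ∃ C : ℝ, ∀ x ∈ Metric.closedBall y s \ {y}, |remainder F y a f m x| ≤ C := by
  obtain ⟨m', hm', C, hC⟩ := h.exists_remainder_bound hs hF 0
  have h1 : ∀ i, i < m' ↔ i < m := fun i => by rw [hm' i, hm i, Nat.cast_zero]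
  have hmm : m' = m := le_antisymm (not_lt.1 fun h2 => lt_irrefl _ ((h1 m).1 h2))
      (not_lt.1 fun h2 => lt_irrefl _ ((h1 m').2 h2))
  subst hmm
  exact ⟨C, by simpa using hC⟩

theorem setIntegral_outside (hF : ContinuousOn F {y₁, y₂}ᶜ) (hinf : SummableAtInfinity F)
    (hs' : 0 < s') (hss : s' ≤ s) (hsy : s < ‖y₁ - y₂‖ / 2) :
    ∫ x in outside y₁ y₂ s', F x = (∫ x in outside y₁ y₂ s, F x) +
      (∫ x in {x : Space | ‖x - y₁‖ ∈ Set.Ioc s' s}, F x) +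
      ∫ x in {x : Space | ‖x - y₂‖ ∈ Set.Ioc s' s}, F x := by
  have hfar : ∀ x : Space, ‖x - y₁‖ ≤ s → s < ‖x - y₂‖ := by
    intro x hx
    by_contra! hx'
    have := norm_sub_le_norm_sub_add_norm_sub y₁ x y₂
    rw [norm_sub_rev y₁ x] at this
    linarith
  have hunion : outside y₁ y₂ s' = outside y₁ y₂ s ∪ {x : Space | ‖x - y₁‖ ∈ Set.Ioc s' s} ∪
      {x : Space | ‖x - y₂‖ ∈ Set.Ioc s' s} := by
    ext x
    simp only [Set.mem_union, mem_outside, Set.mem_ofPred_eq, Set.mem_Ioc]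
    have h1 := hfar x
    constructor
    · rintro ⟨h2, h3⟩
      by_cases h4 : ‖x - y₁‖ ≤ s
      · exact Or.inl (Or.inr ⟨h2, h4⟩)
      · by_cases h5 : ‖x - y₂‖ ≤ s
        · exact Or.inr ⟨h3, h5⟩
        · exact Or.inl (Or.inl ⟨not_le.1 h4, not_le.1 h5⟩)
    · rintro ((⟨h2, h3⟩ | ⟨h2, h3⟩) | ⟨h2, h3⟩)
      · exact ⟨hss.trans_lt h2, hss.trans_lt h3⟩
      · exact ⟨h2, hss.trans_lt (h1 h3)⟩
      · refine ⟨?_, h2⟩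
        by_contra! h4
        exact (h1 (h4.trans hss)).not_ge h3
  have hint := integrableOn_outside (y₁ := y₁) (y₂ := y₂) hs' hF hinf
  rw [hunion] at hint ⊢
  rw [setIntegral_union ?_ (measurableSet_radius_Ioc y₂ s' s)
      (hint.mono_set Set.subset_union_left) (hint.mono_set Set.subset_union_right),
    setIntegral_union ?_ (measurableSet_radius_Ioc y₁ s' s)
      (hint.mono_set (Set.subset_union_left.trans Set.subset_union_left))
      (hint.mono_set (Set.subset_union_right.trans Set.subset_union_left))]
  · rw [Set.disjoint_left]
    intro x hx hx'
    exact (mem_outside.1 hx).1.not_ge hx'.2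
  · rw [Set.disjoint_left]
    rintro x (hx | hx) hx'
    · exact (mem_outside.1 hx).2.not_ge hx'.2
    · exact (hfar x hx.2).not_ge hx'.2

/-- The shells lost by the balls are exactly what the outer region gains. This invariance allows
both the passage to the limit and an arbitrary splitting radius in the continued integral. -/
theorem partieFinieAt_eq (hs₁ : 0 < s₁) (hs₂ : 0 < s₂) (hF : ContinuousOn F {y₁, y₂}ᶜ)
    (hinf : SummableAtInfinity F) (ha : IsSingularExpansion F y₁ a f)
    (hb : IsSingularExpansion F y₂ b g) {m n : ℕ} (hm : ∀ i, i < m ↔ a i ≤ 0)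
    (hn : ∀ i, i < n ↔ b i ≤ 0) (hs' : 0 < s') (hss : s' ≤ s) (hsy : s < ‖y₁ - y₂‖ / 2) :
    partieFinieAt y₁ y₂ s₁ s₂ F a f b g m n s' = partieFinieAt y₁ y₂ s₁ s₂ F a f b g m n s := by
  have hF₁ := continuousOn_closedBall_left hF hsy
  have hF₂ := continuousOn_closedBall_right hF hsy
  have hs := hs'.trans_le hss
  obtain ⟨C₁, hC₁⟩ := ha.exists_bound hm hs hF₁
  obtain ⟨C₂, hC₂⟩ := hb.exists_bound hn hs hF₂
  rw [partieFinieAt, partieFinieAt, setIntegral_outside hF hinf hs' hss hsy,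
    ballFinitePart_sub hs₁ hs' hss hF₁ (ha.continuous_coeff hs hF₁) hC₁,
    ballFinitePart_sub hs₂ hs' hss hF₂ (hb.continuous_coeff hs hF₂) hC₂]
  ring

theorem tendsto_partieFinieAt (hs₁ : 0 < s₁) (hs₂ : 0 < s₂) (hF : ContinuousOn F {y₁, y₂}ᶜ)
    (hinf : SummableAtInfinity F) (ha : IsSingularExpansion F y₁ a f)
    (hb : IsSingularExpansion F y₂ b g) {m n : ℕ} (hm : ∀ i, i < m ↔ a i ≤ 0)
    (hn : ∀ i, i < n ↔ b i ≤ 0) (hs : 0 < s) (hsy : s < ‖y₁ - y₂‖ / 2) :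
    Tendsto (fun t : ℝ =>
      (∫ x in (Metric.closedBall y₁ t ∪ Metric.closedBall y₂ t)ᶜ, F x) +
        counterterm a f s₁ t + counterterm b g s₂ t) (𝓝[>] 0)
      (𝓝 (partieFinieAt y₁ y₂ s₁ s₂ F a f b g m n s)) := by
  obtain ⟨C₁, hC₁⟩ := ha.exists_bound hm hs (continuousOn_closedBall_left hF hsy)
  obtain ⟨C₂, hC₂⟩ := hb.exists_bound hn hs (continuousOn_closedBall_right hF hsy)
  have h1 := ((tendsto_const_nhds (x := partieFinieAt y₁ y₂ s₁ s₂ F a f b g m n s)).sub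
    (tendsto_ballFinitePart_sub_counterterm hs hm hC₁ s₁)).sub
    (tendsto_ballFinitePart_sub_counterterm hs hn hC₂ s₂)
  rw [sub_zero, sub_zero] at h1
  refine h1.congr' ?_
  filter_upwards [Ioc_mem_nhdsGT hs] with t ht
  rw [← partieFinieAt_eq hs₁ hs₂ hF hinf ha hb hm hn ht.1 ht.2 hsy, partieFinieAt, outside]
  ring

theorem integrand_swap (α β : ℂ) :
    integrand y₂ y₁ s₂ s₁ F β α = integrand y₁ y₂ s₁ s₂ F α β := by
  ext1 x
  rw [integrand, integrand, mul_comm (((‖x - y₂‖ / s₂ : ℝ) : ℂ) ^ β)]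

theorem exists_isContinuation_closedBall_right (hy : y₁ ≠ y₂) (hs₁ : 0 < s₁) (hs₂ : 0 < s₂)
    (hF : ContinuousOn F {y₁, y₂}ᶜ) (hb : IsSingularExpansion F y₂ b g) {n : ℕ}
    (hn : ∀ i, i < n ↔ b i ≤ 0) (hs : 0 < s) (hsy : s < ‖y₁ - y₂‖ / 2) :
    ∃ J : ℂ → ℂ → ℂ,
      IsContinuation (fun β α => integrand y₁ y₂ s₁ s₂ F α β) (Metric.closedBall y₂ s) J ∧
      ∃ (γ : ℂ → ℂ) (h : ℂ × ℂ → ℂ), AnalyticAt ℂ γ 0 ∧ AnalyticAt ℂ h (0, 0) ∧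
        h (0, 0) = (ballFinitePart F y₂ b g n s₂ s : ℂ) ∧
        ∀ᶠ z in 𝓝[≠] (0 : ℂ), ∀ w : ℂ, J z w = γ w / z + h (z, w) := by
  have := exists_isContinuation_closedBall hy.symm hs₂ hs₁ hs (by rwa [norm_sub_rev])
    (continuousOn_closedBall_right hF hsy) hb hn
  simpa only [integrand_swap] using this

theorem exists_isContinuedIntegral (hy : y₁ ≠ y₂) (hs₁ : 0 < s₁) (hs₂ : 0 < s₂)
    (hF : ContinuousOn F {y₁, y₂}ᶜ) (hinf : SummableAtInfinity F)
    (ha : IsSingularExpansion F y₁ a f) (hb : IsSingularExpansion F y₂ b g) {m n : ℕ}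
    (hm : ∀ i, i < m ↔ a i ≤ 0) (hn : ∀ i, i < n ↔ b i ≤ 0) :
    ∃ J : ℂ → ℂ → ℂ, IsContinuedIntegral y₁ y₂ s₁ s₂ F J := by
  have hρ : 0 < ‖y₁ - y₂‖ := norm_pos_iff.2 (sub_ne_zero.2 hy)
  have hs : 0 < ‖y₁ - y₂‖ / 4 := by positivity
  have hsy : ‖y₁ - y₂‖ / 4 < ‖y₁ - y₂‖ / 2 := by linarith
  obtain ⟨J₁, hJ₁, -⟩ := exists_isContinuation_closedBall hy hs₁ hs₂ hs hsy
    (continuousOn_closedBall_left hF hsy) ha hm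
  obtain ⟨J₂, hJ₂, -⟩ := exists_isContinuation_closedBall_right hy hs₁ hs₂ hF hb hn hs hsy
  obtain ⟨⟨δ, hδ, hint⟩, -⟩ := exists_analyticAt_outside hs₁ hs₂ hs hF hinf
  exact ⟨fun α β => J₁ α β + J₂ β α + ∫ x in outside y₁ y₂ (‖y₁ - y₂‖ / 4),
      integrand y₁ y₂ s₁ s₂ F α β x, _, hs, hsy, J₁, fun α β => J₂ β α, hJ₁, hJ₂, δ, hδ, hint,
    fun α β _ _ _ _ => rfl⟩

theorem IsContinuedIntegral.hasIteratedFinitePart {J : ℂ → ℂ → ℂ}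
    (hJ : IsContinuedIntegral y₁ y₂ s₁ s₂ F J) (hy : y₁ ≠ y₂) (hs₁ : 0 < s₁) (hs₂ : 0 < s₂)
    (hF : ContinuousOn F {y₁, y₂}ᶜ) (hinf : SummableAtInfinity F)
    (ha : IsSingularExpansion F y₁ a f) (hb : IsSingularExpansion F y₂ b g) {m n : ℕ}
    (hm : ∀ i, i < m ↔ a i ≤ 0) (hn : ∀ i, i < n ↔ b i ≤ 0) :
    ∃ s : ℝ, 0 < s ∧ s < ‖y₁ - y₂‖ / 2 ∧
      HasIteratedFinitePart J (partieFinieAt y₁ y₂ s₁ s₂ F a f b g m n s : ℂ) ∧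
      HasIteratedFinitePart (fun β α => J α β)
        (partieFinieAt y₁ y₂ s₁ s₂ F a f b g m n s : ℂ) := by
  obtain ⟨s, hs, hsy, J₁, J₂, hJ₁, hJ₂, δ, hδ, -, hJ⟩ := hJ
  refine ⟨s, hs, hsy, ?_⟩
  obtain ⟨K₁, hK₁, γ₁, h₁, hγ₁, hh₁, hh₁0, hK₁e⟩ := exists_isContinuation_closedBall hy hs₁ hs₂ hs
    hsy (continuousOn_closedBall_left hF hsy) ha hm
  obtain ⟨K₂, hK₂, γ₂, h₂, hγ₂, hh₂, hh₂0, hK₂e⟩ :=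
    exists_isContinuation_closedBall_right hy hs₁ hs₂ hF hb hn hs hsy
  obtain ⟨-, hout⟩ := exists_analyticAt_outside (y₁ := y₁) (y₂ := y₂) hs₁ hs₂ hs hF hinf
  have hradius : ∀ {p : ℂ → Prop}, (∀ᶠ z in 𝓝[≠] (0 : ℂ), p z) →
      ∃ η > 0, ∀ z : ℂ, 0 < ‖z‖ → ‖z‖ < η → p z := by
    intro p hp
    rw [eventually_nhdsWithin_iff, Metric.eventually_nhds_iff] at hp
    obtain ⟨η, hη, h⟩ := hp
    exact ⟨η, hη, fun z hz hz' => h (by simpa using hz') (norm_pos_iff.1 hz)⟩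
  -- The given continuation is replaced near the origin by the constructed one, whose polar form is
  -- known; the radius does not depend on the other variable.
  obtain ⟨η₁, hη₁, hJ₁e⟩ := hradius ((hJ₁.eventually_eq hK₁).and hK₁e)
  obtain ⟨η₂, hη₂, hJ₂e⟩ := hradius ((hJ₂.eventually_eq hK₂).and hK₂e)
  let h : ℂ × ℂ → ℂ := fun p => h₁ p + h₂ p.swap +
    ∫ x in outside y₁ y₂ s, integrand y₁ y₂ s₁ s₂ F p.1 p.2 x
  have hswap : AnalyticAt ℂ (Prod.swap : ℂ × ℂ → ℂ × ℂ) (0, 0) :=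
    analyticAt_snd.prod analyticAt_fst
  have hh : AnalyticAt ℂ h (0, 0) :=
    (hh₁.add (AnalyticAt.comp (f := Prod.swap) (x := ((0 : ℂ), (0 : ℂ))) hh₂ hswap)).add hout
  have hh0 : h (0, 0) = (partieFinieAt y₁ y₂ s₁ s₂ F a f b g m n s : ℂ) := by
    have h0 : ∀ x, integrand y₁ y₂ s₁ s₂ F 0 0 x = (F x : ℂ) := fun x => by simp [integrand]
    simp only [h, Prod.swap_prod_mk, hh₁0, hh₂0, h0, partieFinieAt]
    rw [integral_complex_ofReal]
    push_cast
    ring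
  have hε : 0 < min δ (min η₁ η₂) := by positivity
  have hsum : ∀ z w : ℂ, 0 < ‖z‖ → ‖z‖ < min δ (min η₁ η₂) → 0 < ‖w‖ → ‖w‖ < min δ (min η₁ η₂) →
      J z w = γ₁ w / z + γ₂ z / w + h (z, w) := by
    intro z w hz hz' hw hw'
    rw [lt_min_iff, lt_min_iff] at hz' hw'
    obtain ⟨e1, e2⟩ := hJ₁e z hz hz'.2.1
    obtain ⟨e3, e4⟩ := hJ₂e w hw hw'.2.2
    rw [hJ z w hz hz'.1 hw hw'.1, e1 w, e2 w, e3 z, e4 z]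
    simp only [h, Prod.swap_prod_mk, outside]
    ring
  rw [← hh0]
  refine ⟨hasIteratedFinitePart_of_simple_poles hγ₂ hh hε hsum, ?_⟩
  refine hasIteratedFinitePart_of_simple_poles (J := fun β α => J α β) (γ₁ := γ₂)
    (g := fun p => h p.swap) hγ₁
    (AnalyticAt.comp (f := Prod.swap) (x := ((0 : ℂ), (0 : ℂ))) hh hswap) hε ?_
  intro w z hw hw' hz hz'
  rw [hsum z w hz hz' hw hw', Prod.swap_prod_mk]
  ring

end

end HadamardPf

end

theorem theorem2 (y₁ y₂ : HadamardPf.Space) (hy : y₁ ≠ y₂) (s₁ s₂ : ℝ) (hs₁ : 0 < s₁) (hs₂ : 0 < s₂)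
    (F : HadamardPf.Space → ℝ) (hF : HadamardPf.MemClass y₁ y₂ F)
    (hinf : HadamardPf.SummableAtInfinity F) :
    ∃ P : ℝ, HadamardPf.HasPartieFinie y₁ y₂ s₁ s₂ F P ∧
      (∃ J : ℂ → ℂ → ℂ, HadamardPf.IsContinuedIntegral y₁ y₂ s₁ s₂ F J) ∧
      ∀ J : ℂ → ℂ → ℂ, HadamardPf.IsContinuedIntegral y₁ y₂ s₁ s₂ F J →
        HadamardPf.HasIteratedFinitePart (fun α β => J α β) (P : ℂ) ∧
        HadamardPf.HasIteratedFinitePart (fun β α => J α β) (P : ℂ) := by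
  have hFc : ContinuousOn F {y₁, y₂}ᶜ := hF.smooth.continuousOn
  obtain ⟨a, f, ha⟩ := hF.expansion₁
  obtain ⟨b, g, hb⟩ := hF.expansion₂
  obtain ⟨m, hm, -⟩ := ha.2 0
  obtain ⟨n, hn, -⟩ := hb.2 0
  rw [Nat.cast_zero] at hm hn
  have hρ : 0 < ‖y₁ - y₂‖ := norm_pos_iff.2 (sub_ne_zero.2 hy)
  have hs : 0 < ‖y₁ - y₂‖ / 4 := by positivity
  have hsy : ‖y₁ - y₂‖ / 4 < ‖y₁ - y₂‖ / 2 := by linarith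
  have hFP : ∀ {a b f g} {m n : ℕ}, HadamardPf.IsSingularExpansion F y₁ a f →
      HadamardPf.IsSingularExpansion F y₂ b g → (∀ i, i < m ↔ a i ≤ 0) → (∀ i, i < n ↔ b i ≤ 0) →
      ∀ J : ℂ → ℂ → ℂ, HadamardPf.IsContinuedIntegral y₁ y₂ s₁ s₂ F J →
        HadamardPf.HasIteratedFinitePart J
          (HadamardPf.partieFinieAt y₁ y₂ s₁ s₂ F a f b g m n (‖y₁ - y₂‖ / 4) : ℂ) ∧
        HadamardPf.HasIteratedFinitePart (fun β α => J α β)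
          (HadamardPf.partieFinieAt y₁ y₂ s₁ s₂ F a f b g m n (‖y₁ - y₂‖ / 4) : ℂ) := by
    intro a b f g m n ha hb hm hn J hJ
    obtain ⟨s, hs', hsy', h⟩ := hJ.hasIteratedFinitePart hy hs₁ hs₂ hFc hinf ha hb hm hn
    rcases le_total s (‖y₁ - y₂‖ / 4) with hle | hle
    · rwa [HadamardPf.partieFinieAt_eq hs₁ hs₂ hFc hinf ha hb hm hn hs' hle hsy] at h
    · rwa [← HadamardPf.partieFinieAt_eq hs₁ hs₂ hFc hinf ha hb hm hn hs hle hsy'] at h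
  have hex := HadamardPf.exists_isContinuedIntegral hy hs₁ hs₂ hFc hinf ha hb hm hn
  refine ⟨HadamardPf.partieFinieAt y₁ y₂ s₁ s₂ F a f b g m n (‖y₁ - y₂‖ / 4), ?_, hex,
    hFP ha hb hm hn⟩
  intro a' f' b' g' ha' hb'
  obtain ⟨m', hm', -⟩ := ha'.2 0
  obtain ⟨n', hn', -⟩ := hb'.2 0
  rw [Nat.cast_zero] at hm' hn'
  -- Other expansions give the same number without comparing coefficients: both values are the
  -- iterated finite part of one and the same `J`, and that is unique.
  obtain ⟨J, hJ⟩ := hex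
  have heq := (hFP ha hb hm hn J hJ).1.unique (hFP ha' hb' hm' hn' J hJ).1
  rw [Complex.ofReal_inj.1 heq]
  exact HadamardPf.tendsto_partieFinieAt hs₁ hs₂ hFc hinf ha' hb' hm' hn' hs hsy
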